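/- **Tilings.** A tiling of the Euclidean plane is a countable family of closed topological discs that cover the plane and have pairwise disjoint interiors. A protoset admits a tiling if every tile of the tiling is congruent to some prototile (reflections are allowed, and not every prototile has to be used). Two tilings are congruent if an isometry of the plane maps the tiles of one onto the tiles of the other. A protoset is $\sigma$-morphic if it admits exactly $\aleph_0$ tilings up to congruence. **The protoset.** For $l<a<r$ let $\Lambda_{l,a,r}(x)=8\max\bigl(0,\min\bigl(\tfrac{x-l}{a-l},\tfrac{r-x}{r-a}\bigr)\bigr)$, whose graph is a triangle of height $8$ with feet $l,r$ and apex over $a$. Each prototile is the square $[0,64]^2$ with triangular bumps and nicks, $$T=\{(x,y): s(y)\le x\le 64+s(y),\ b(x)\le y\le 64+u(x)\},$$ where, with $X=\Lambda_{14,16,24}-\Lambda_{40,48,50}$ and $Y=\Lambda_{14,16,25}-\Lambda_{46,48,58}$, * purple: $s=\Lambda_{14,16,19}-\Lambda_{46,48,52}$, lower side $b=Y$, upper side $u=Y$; * green: $s=\Lambda_{14,16,21}-\Lambda_{46,48,54}$, $b=X$, $u=Y$; * red: $s=\Lambda_{14,16,23}-\Lambda_{41,48,50}$, $b=u=X$.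 **Theorem.** These three prototiles are closed topological discs, no two of them congruent, and the protoset consisting of them is $\sigma$-morphic. More precisely, every tiling that it admits is congruent to exactly one of the following tilings, each of which it does admit. In each of them the $j$-th row, $j\in\mathbb Z$ (counted upwards), consists of the translates by $(64i,64j)$, $i\in\mathbb Z$, of a single tile: 1. all rows are purple; 2. all rows are red; 3. one row is green, all rows above it are purple, and all rows below it are red; 4. for an integer $n\ge 0$: one row is green, all rows above it are purple, directly below it there are exactly $n$ red rows, then a green row turned by $180^\circ$, and all rows below that are purple rows turned by $180^\circ$. -/

import Mathlib

/-! Tilings of the Euclidean plane -/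

/-- The Euclidean plane. -/
abbrev Plane : Type := EuclideanSpace ℝ (Fin 2)

/-- `T` is a closed topological disc. -/
def IsClosedDisc (T : Set Plane) : Prop :=
  Nonempty (T ≃ₜ Metric.closedBall (0 : Plane) 1)

/-- Two figures are congruent if an isometry of the plane (possibly a reflection) maps one
onto the other. -/
def CongruentFigures (S T : Set Plane) : Prop :=
  ∃ φ : Plane ≃ᵢ Plane, φ '' S = T

/-- A tiling: countably many closed topological discs that cover the plane and have pairwise
disjoint interiors. -/
structure IsTiling (𝒯 : Set (Set Plane)) : Prop where
  countable : 𝒯.Countable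
  isClosedDisc : ∀ T ∈ 𝒯, IsClosedDisc T
  covers : ⋃₀ 𝒯 = Set.univ
  interiors : ∀ S ∈ 𝒯, ∀ T ∈ 𝒯, S ≠ T → interior S ∩ interior T = ∅

/-- `𝒯` is a tiling admitted by the protoset `𝓟`: every tile is congruent to a prototile. -/
structure IsTilingBy (𝓟 𝒯 : Set (Set Plane)) : Prop where
  isTiling : IsTiling 𝒯
  congruent : ∀ T ∈ 𝒯, ∃ P ∈ 𝓟, CongruentFigures P T

/-- Two tilings are congruent if an isometry of the plane maps the tiles of one onto the tiles
of the other. -/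
def CongruentTilings (𝒯₁ 𝒯₂ : Set (Set Plane)) : Prop :=
  ∃ φ : Plane ≃ᵢ Plane, (fun T : Set Plane => φ '' T) '' 𝒯₁ = 𝒯₂

theorem CongruentTilings.refl (𝒯 : Set (Set Plane)) : CongruentTilings 𝒯 𝒯 :=
  ⟨IsometryEquiv.refl Plane, by
    conv_rhs => rw [← Set.image_id 𝒯]
    exact Set.image_congr fun T _ => Set.image_id T⟩

theorem CongruentTilings.symm {𝒯₁ 𝒯₂ : Set (Set Plane)} (h : CongruentTilings 𝒯₁ 𝒯₂) :
    CongruentTilings 𝒯₂ 𝒯₁ := by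
  obtain ⟨φ, rfl⟩ := h
  refine ⟨φ.symm, ?_⟩
  rw [Set.image_image]
  conv_rhs => rw [← Set.image_id 𝒯₁]
  refine Set.image_congr fun T _ => ?_
  rw [Set.image_image]
  simp

theorem CongruentTilings.trans {𝒯₁ 𝒯₂ 𝒯₃ : Set (Set Plane)} (h : CongruentTilings 𝒯₁ 𝒯₂)
    (h' : CongruentTilings 𝒯₂ 𝒯₃) : CongruentTilings 𝒯₁ 𝒯₃ := by
  obtain ⟨φ, rfl⟩ := h
  obtain ⟨ψ, rfl⟩ := h'
  refine ⟨φ.trans ψ, ?_⟩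
  rw [Set.image_image]
  refine Set.image_congr fun T _ => ?_
  rw [Set.image_image]
  rfl

/-- Congruence of the tilings admitted by `𝓟`. -/
def tilingSetoid (𝓟 : Set (Set Plane)) : Setoid {𝒯 : Set (Set Plane) // IsTilingBy 𝓟 𝒯} where
  r 𝒯₁ 𝒯₂ := CongruentTilings 𝒯₁.1 𝒯₂.1
  iseqv := ⟨fun 𝒯 => CongruentTilings.refl 𝒯.1, fun h => h.symm, fun h h' => h.trans h'⟩

/-- A protoset is σ-morphic if it admits exactly `ℵ₀` tilings of the plane up to isometry. -/
def IsSigmaMorphic (𝓟 : Set (Set Plane)) : Prop :=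
  Cardinal.mk (Quotient (tilingSetoid 𝓟)) = Cardinal.aleph0

/-! The three prototiles: squares of side 64 with triangular bumps and nicks of height 8 -/

noncomputable section

/-- The graph of a triangle of height 8 with feet at `l`, `r` and apex over `a`
(for `l < a < r`); it vanishes outside of `[l, r]`. -/
def tent (l a r x : ℝ) : ℝ :=
  8 * max 0 (min ((x - l) / (a - l)) ((r - x) / (r - a)))

/-- The square `[0, 64]²` whose left and right sides are replaced by the translates
`x = side y` and `x = 64 + side y` of one curve, the lower side by `y = low x`, and the upper
side by `y = 64 + up x`. -/
def block (side low up : ℝ → ℝ) : Set Plane :=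
  {p | side (p 1) ≤ p 0 ∧ p 0 ≤ 64 + side (p 1) ∧ low (p 0) ≤ p 1 ∧ p 1 ≤ 64 + up (p 0)}

/-- The left side of the purple tile, with a nick at height 16 and a bump at height 48. -/
def purpleSide (y : ℝ) : ℝ := tent 14 16 19 y - tent 46 48 52 y

/-- The left side of the green tile. -/
def greenSide (y : ℝ) : ℝ := tent 14 16 21 y - tent 46 48 54 y

/-- The left side of the red tile; symmetric under the half-turn: `redSide (64 - y) = -redSide y`. -/
def redSide (y : ℝ) : ℝ := tent 14 16 23 y - tent 41 48 50 y

/-- The lower sides of the green and the red tile and the upper side of the red tile;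
symmetric under the half-turn: `selfProfile (64 - x) = -selfProfile x`. -/
def selfProfile (x : ℝ) : ℝ := tent 14 16 24 x - tent 40 48 50 x

/-- The upper sides of the purple and the green tile and the lower side of the purple tile. -/
def upProfile (x : ℝ) : ℝ := tent 14 16 25 x - tent 46 48 58 x

def purpleTile : Set Plane := block purpleSide upProfile upProfile

def greenTile : Set Plane := block greenSide selfProfile upProfile

def redTile : Set Plane := block redSide selfProfile selfProfile

/-- The protoset. -/
def rowProtoset : Set (Set Plane) := {purpleTile, greenTile, redTile}

/-! The tilings by rows of translates -/

/-- The figure `T` turned by 180 degrees about the centre `(32, 32)` of the square. -/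
def turned (T : Set Plane) : Set Plane :=
  {p | (!₂[64 - p 0, 64 - p 1] : Plane) ∈ T}

/-- The translate of `T` by `(64 i, 64 j)`. -/
def shifted (T : Set Plane) (i j : ℤ) : Set Plane :=
  {p | (!₂[p 0 - 64 * (i : ℝ), p 1 - 64 * (j : ℝ)] : Plane) ∈ T}

/-- The tiles whose `j`-th row (counted upwards, `j ∈ ℤ`) consists of translates of `r j`. -/
def rowTiling (r : ℤ → Set Plane) : Set (Set Plane) :=
  {T | ∃ i j : ℤ, T = shifted (r j) i j}

/-- The names of the tilings. -/
inductive RowPattern : Type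
  /-- all rows are purple -/
  | allPurple : RowPattern
  /-- all rows are red -/
  | allRed : RowPattern
  /-- a green row, all rows above it purple, all rows below it red -/
  | greenOverRed : RowPattern
  /-- a green row with all rows above it purple, below it exactly `n` red rows, then a green
  row turned upside down, and below that only purple rows turned upside down -/
  | redBetweenGreen (n : ℕ) : RowPattern

/-- The tile of which the `j`-th row consists. -/
def RowPattern.row : RowPattern → ℤ → Set Plane
  | .allPurple, _ => purpleTile
  | .allRed, _ => redTile
  | .greenOverRed, j => if 0 < j then purpleTile else if j = 0 then greenTile else redTile
  | .redBetweenGreen n, j =>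
      if 0 < j then purpleTile
      else if j = 0 then greenTile
      else if -(n : ℤ) ≤ j then redTile
      else if j = -(n : ℤ) - 1 then turned greenTile
      else turned purpleTile

/-- The tiling with a given name. -/
def RowPattern.tiling (c : RowPattern) : Set (Set Plane) := rowTiling c.row

end

/-! Each side of a prototile carries one bump and one nick. A bump is a triangle of height 8 whose
short leg has horizontal extent 2 and whose long leg has horizontal extent `d`, its type. The types
separate the possible contacts: 3 and 4 for purple sides, 5 and 6 for green ones, 7 for red ones, 8
for the curve `selfProfile`, 9 and 10 for `upProfile`. The core of the proof is that a nick is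
filled by exactly one tile, with a bump of the same type, in exactly one position
(`IsTilingBy.exists_fills`, `Kind.exists_bumpIso_eq`).

This rests on the geometry at the apex of a nick. Its angle is acute, whereas from every point of a
prototile other than a bump apex one can set out in two directions that form no acute angle
(`Kind.hasWideAngle`). So each other tile at the apex has a bump apex there. The direction `middle`
cuts the angle into two parts, both narrower than the narrowest bump, hence it is interior to every
bump in the nick (`IsLegs.middle_mem`). Two such tiles would overlap along it, so one tile alone
fills the nick near its apex. The cotangent of the angle decreases strictly with `d`, so the types
agree. The isometry then fixes both legs or exchanges their directions; in the latter case the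
straight piece of side next to the short leg would leave the nick (`Fills.eq_refl`).

What remains is combinatorial. A fitting neighbour is a translate, or, for the curves symmetric
under the half-turn, possibly a turned translate (`Kind.bumpIso_symm_trans_nickIso`). Hence rows are
uniform. Above a purple or green row comes a purple one; below a purple row comes purple or green;
below a green or red row comes red or turned green; above a red row comes red or green. Without
green, all rows are of one kind. With green, everything above is purple, and below it the rows are
red either forever or until the first turned green row, below which, by the same argument upside
down, everything is turned purple.

Conversely the patterns are tilings because adjacent rows share their boundary curve (`RowCurves`).
Non-congruence holds because bump types are invariant under isometries and the green tile has no
symmetry: an isometry between two patterns with green is fixed by the image of one green tile, so it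
is a translation or a half-turn that respects the rows. -/

noncomputable section

/-! ### Triangles and the profiles of the sides -/

/-- The triangle of height 8 with apex over `0`, feet at `-2` and `d`. -/
def spike (d x : ℝ) : ℝ := max 0 (min (8 + 4 * x) (8 - 8 * x / d))

theorem tent_nonneg (l a r x : ℝ) : 0 ≤ tent l a r x := by
  unfold tent
  positivity

theorem tent_le {l a r : ℝ} (hl : l < a) (hr : a < r) (x : ℝ) : tent l a r x ≤ 8 := by
  have h : max 0 (min ((x - l) / (a - l)) ((r - x) / (r - a))) ≤ 1 := by
    refine max_le zero_le_one ?_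
    rcases le_total x a with h | h
    · exact (min_le_left _ _).trans (by rw [div_le_one (by linarith)]; linarith)
    · exact (min_le_right _ _).trans (by rw [div_le_one (by linarith)]; linarith)
  unfold tent
  linarith

theorem tent_eq_zero_of_le {l a r x : ℝ} (hl : l < a) (hx : x ≤ l) : tent l a r x = 0 := by
  have h : (x - l) / (a - l) ≤ 0 := div_nonpos_of_nonpos_of_nonneg (by linarith) (by linarith)
  simp [tent, max_eq_left ((min_le_left _ _).trans h)]

theorem tent_eq_zero_of_ge {l a r x : ℝ} (hr : a < r) (hx : r ≤ x) : tent l a r x = 0 := by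
  have h : (r - x) / (r - a) ≤ 0 := div_nonpos_of_nonpos_of_nonneg (by linarith) (by linarith)
  simp [tent, max_eq_left ((min_le_right _ _).trans h)]

theorem tent_monotoneOn {l a r : ℝ} (hl : l < a) (hr : a < r) :
    MonotoneOn (tent l a r) (Set.Iic a) := by
  intro x hx y hy hxy
  simp only [Set.mem_Iic] at hx hy
  have h1 : (x - l) / (a - l) ≤ (y - l) / (a - l) := by gcongr
  have h2 : (y - l) / (a - l) ≤ 1 := by rw [div_le_one (by linarith)]; linarith
  have h3 : 1 ≤ (r - y) / (r - a) := by rw [one_le_div (by linarith)]; linarith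
  unfold tent
  gcongr 8 * max 0 ?_
  rw [min_eq_left (h2.trans h3)]
  exact (min_le_left _ _).trans h1

theorem tent_antitoneOn {l a r : ℝ} (hl : l < a) (hr : a < r) :
    AntitoneOn (tent l a r) (Set.Ici a) := by
  intro x hx y hy hxy
  simp only [Set.mem_Ici] at hx hy
  have h1 : (r - y) / (r - a) ≤ (r - x) / (r - a) := by gcongr
  have h2 : (r - x) / (r - a) ≤ 1 := by rw [div_le_one (by linarith)]; linarith
  have h3 : 1 ≤ (x - l) / (a - l) := by rw [one_le_div (by linarith)]; linarith
  unfold tent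
  gcongr 8 * max 0 ?_
  rw [min_eq_right (h2.trans h3)]
  exact (min_le_right _ _).trans h1

theorem tent_lipschitz {l a r : ℝ} (hl : l + 2 ≤ a) (hr : a + 2 ≤ r) (x y : ℝ) :
    |tent l a r x - tent l a r y| ≤ 4 * |x - y| := by
  have h1 : |(x - l) / (a - l) - (y - l) / (a - l)| ≤ 1 / 2 * |x - y| := by
    rw [← sub_div, abs_div, abs_of_pos (show 0 < a - l by linarith), div_le_iff₀ (by linarith),
      sub_sub_sub_cancel_right]
    nlinarith [abs_nonneg (x - y)]
  have h2 : |(r - x) / (r - a) - (r - y) / (r - a)| ≤ 1 / 2 * |x - y| := by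
    rw [← sub_div, abs_div, abs_of_pos (show 0 < r - a by linarith), div_le_iff₀ (by linarith),
      sub_sub_sub_cancel_left, abs_sub_comm]
    nlinarith [abs_nonneg (x - y)]
  have h3 := abs_min_sub_min_le_max ((x - l) / (a - l)) ((r - x) / (r - a))
    ((y - l) / (a - l)) ((r - y) / (r - a))
  have h4 := abs_max_sub_max_le_max 0 (min ((x - l) / (a - l)) ((r - x) / (r - a)))
    0 (min ((y - l) / (a - l)) ((r - y) / (r - a)))
  unfold tent
  rw [← mul_sub, abs_mul, abs_of_pos (by norm_num : (0 : ℝ) < 8)]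
  have h5 : (0 : ℝ) ≤ 1 / 2 * |x - y| := by positivity
  have h6 := h4.trans (max_le (by simp) (h3.trans (max_le h1 h2)))
  linarith

theorem tent_add_eq_spike {l a d : ℝ} (hl : a - l = 2) (hd : 0 < d) (x : ℝ) :
    tent l a (a + d) (a + x) = spike d x := by
  unfold tent spike
  rw [mul_max_of_nonneg _ _ (by norm_num), mul_min_of_nonneg _ _ (by norm_num), hl]
  congr 2
  · ring
  · linarith
  · rw [show a + d - a = d by ring]
    field_simp
    ring

theorem tent_sub_eq_spike {r a d : ℝ} (hr : r - a = 2) (hd : 0 < d) (x : ℝ) :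
    tent (a - d) a r (a - x) = spike d x := by
  unfold tent spike
  rw [mul_max_of_nonneg _ _ (by norm_num), mul_min_of_nonneg _ _ (by norm_num), hr, min_comm]
  congr 2
  · ring
  · linarith
  · rw [show a - (a - d) = d by ring]
    field_simp
    ring

/-- Strictly above the base, at height -8 relative to the apex, the flat part of the graph is
irrelevant and only the two lines through the apex remain. This turns bumps and nicks into angles.
-/
theorem lt_spike_iff {d x y : ℝ} (hd : 0 < d) (hy : -8 < y) :
    8 + y < spike d x ↔ y < 4 * x ∧ d * y < -8 * x := by
  have h : 8 + y < 8 - 8 * x / d ↔ d * y < -8 * x := by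
    rw [show d * y < -8 * x ↔ y < (-8 * x) / d by rw [lt_div_iff₀' hd]]
    rw [show -8 * x / d = -(8 * x / d) by ring]
    constructor <;> intro h <;> linarith
  rw [spike, lt_max_iff, lt_min_iff, h]
  constructor
  · rintro (h | ⟨h1, h2⟩)
    · linarith
    · exact ⟨by linarith, h2⟩
  · rintro ⟨h1, h2⟩
    exact Or.inr ⟨by linarith, h2⟩

theorem le_spike_iff {d x y : ℝ} (hd : 0 < d) (hy : -8 < y) :
    8 + y ≤ spike d x ↔ y ≤ 4 * x ∧ d * y ≤ -8 * x := by
  have h : 8 + y ≤ 8 - 8 * x / d ↔ d * y ≤ -8 * x := by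
    rw [show d * y ≤ -8 * x ↔ y ≤ (-8 * x) / d by rw [le_div_iff₀' hd]]
    rw [show -8 * x / d = -(8 * x / d) by ring]
    constructor <;> intro h <;> linarith
  rw [spike, le_max_iff, le_min_iff, h]
  constructor
  · rintro (h | ⟨h1, h2⟩)
    · linarith
    · exact ⟨by linarith, h2⟩
  · rintro ⟨h1, h2⟩
    exact Or.inr ⟨by linarith, h2⟩

/-- The sign `±1` as a real number. -/
def sgn (σ : ℤˣ) : ℝ := ((σ : ℤ) : ℝ)

@[simp] theorem sgn_one : sgn 1 = 1 := by simp [sgn]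

@[simp] theorem sgn_neg_one : sgn (-1) = -1 := by simp [sgn]

@[simp] theorem sgn_mul_self (σ : ℤˣ) : sgn σ * sgn σ = 1 := by
  rcases Int.units_eq_one_or σ with rfl | rfl <;> simp

@[simp] theorem sgn_mul_sgn_mul (σ : ℤˣ) (x : ℝ) : sgn σ * (sgn σ * x) = x := by
  rw [← mul_assoc, sgn_mul_self, one_mul]

/-- The functions whose graphs are the sides of the prototiles: a triangle of type `d₁` upwards
with apex over `16`, and a triangle of type `d₂` downwards with apex over `48`, which is reflected
if `σ = -1`. -/
structure Profile (f : ℝ → ℝ) (d₁ d₂ : ℝ) (σ : ℤˣ) : Prop where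
  type₁ : 3 ≤ d₁ ∧ d₁ ≤ 10
  type₂ : 3 ≤ d₂ ∧ d₂ ≤ 10
  monotoneOn_Iic : MonotoneOn f (Set.Iic 16)
  antitoneOn_Icc : AntitoneOn f (Set.Icc 16 48)
  monotoneOn_Ici : MonotoneOn f (Set.Ici 48)
  lipschitz : ∀ x y, |f x - f y| ≤ 8 * |x - y|
  le_eight : ∀ x, f x ≤ 8
  neg_eight_le : ∀ x, -8 ≤ f x
  eq_zero_left : ∀ x, x ≤ 14 → f x = 0
  eq_zero_right : ∀ x, 58 ≤ x → f x = 0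
  near_up : ∀ x, -3 < x → x < 7 → f (16 + x) = spike d₁ x
  near_down : ∀ x, -3 < x → x < 7 → f (48 + sgn σ * x) = -spike d₂ x

/-- The supports are disjoint, since `r₁ ≤ 26` and `40 ≤ l₂`; the latter is what `d₂ ≤ 8` secures in
the reflected case. Near either apex only one triangle counts. -/
theorem profile_of_tents {r₁ l₂ r₂ d₁ d₂ : ℝ} {σ : ℤˣ} (h₁ : 3 ≤ d₁ ∧ d₁ ≤ 10)
    (h₂ : 3 ≤ d₂ ∧ d₂ ≤ 10) (hr₁ : r₁ = 16 + d₁)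
    (h : (σ = 1 ∧ l₂ = 46 ∧ r₂ = 48 + d₂) ∨ (σ = -1 ∧ l₂ = 48 - d₂ ∧ r₂ = 50 ∧ d₂ ≤ 8)) :
    Profile (fun x => tent 14 16 r₁ x - tent l₂ 48 r₂ x) d₁ d₂ σ := by
  have hr₁' : 16 + 2 ≤ r₁ := by linarith [h₁.1]
  have hr₁'' : r₁ ≤ 26 := by linarith [h₁.2]
  have hl₂ : l₂ + 2 ≤ 48 := by rcases h with h | h <;> linarith [h.2.1, h₂.1]
  have hl₂' : 40 ≤ l₂ := by rcases h with h | h <;> linarith [h.2.1, h₂.1, h.2.2]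
  have hr₂ : 48 + 2 ≤ r₂ := by rcases h with h | h <;> linarith [h.2.2, h₂.1]
  have hr₂' : r₂ ≤ 58 := by rcases h with h | h <;> linarith [h.2.2, h₂.2]
  have e₁ : ∀ x, x ≤ 14 → tent 14 16 r₁ x = 0 := fun x hx => tent_eq_zero_of_le (by norm_num) hx
  have e₁' : ∀ x, r₁ ≤ x → tent 14 16 r₁ x = 0 := fun x hx => tent_eq_zero_of_ge (by linarith) hx
  have e₂ : ∀ x, x ≤ l₂ → tent l₂ 48 r₂ x = 0 := fun x hx => tent_eq_zero_of_le (by linarith) hx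
  have e₂' : ∀ x, r₂ ≤ x → tent l₂ 48 r₂ x = 0 := fun x hx => tent_eq_zero_of_ge (by linarith) hx
  refine ⟨h₁, h₂, ?_, ?_, ?_, ?_, ?_, ?_, ?_, ?_, ?_, ?_⟩
  · intro x hx y hy hxy
    simp only [Set.mem_Iic] at hx hy
    simp only [e₂ x (by linarith), e₂ y (by linarith), sub_zero]
    exact tent_monotoneOn (by norm_num) (by linarith) hx hy hxy
  · intro x hx y hy hxy
    have t₁ := tent_antitoneOn (l := 14) (a := 16) (r := r₁) (by norm_num) (by linarith)
      hx.1 hy.1 hxy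
    have t₂ := tent_monotoneOn (l := l₂) (a := 48) (r := r₂) (by linarith) (by linarith)
      hx.2 hy.2 hxy
    linarith
  · intro x hx y hy hxy
    simp only [Set.mem_Ici] at hx hy
    have t₂ := tent_antitoneOn (l := l₂) (a := 48) (r := r₂) (by linarith) (by linarith)
      hx hy hxy
    simp only [e₁' x (by linarith), e₁' y (by linarith), zero_sub]
    linarith
  · intro x y
    have t₁ := tent_lipschitz (l := 14) (a := 16) (by norm_num) hr₁' x y
    have t₂ := tent_lipschitz hl₂ hr₂ x y
    rw [abs_le] at *
    constructor <;> linarith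
  · intro x
    have t₁ := tent_le (l := 14) (a := 16) (r := r₁) (by norm_num) (by linarith) x
    have t₂ := tent_nonneg l₂ 48 r₂ x
    linarith
  · intro x
    have t₁ := tent_nonneg 14 16 r₁ x
    have t₂ := tent_le (l := l₂) (a := 48) (r := r₂) (by linarith) (by linarith) x
    linarith
  · intro x hx
    simp [e₁ x hx, e₂ x (by linarith)]
  · intro x hx
    simp [e₁' x (by linarith), e₂' x (by linarith)]
  · intro x hx hx'
    simp only [e₂ (16 + x) (by linarith), sub_zero]
    rw [hr₁, tent_add_eq_spike (by norm_num) (by linarith)]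
  · intro x hx hx'
    have hs : r₁ ≤ 48 + sgn σ * x := by
      rcases h with ⟨rfl, _⟩ | ⟨rfl, _⟩ <;> simp <;> linarith
    simp only [e₁' _ hs, zero_sub, neg_inj]
    rcases h with ⟨rfl, rfl, rfl⟩ | ⟨rfl, rfl, rfl, _⟩
    · rw [sgn_one, one_mul, tent_add_eq_spike (by norm_num) (by linarith)]
    · rw [sgn_neg_one, neg_one_mul, ← sub_eq_add_neg,
        tent_sub_eq_spike (by norm_num) (by linarith)]

theorem purpleSide_profile : Profile purpleSide 3 4 1 :=
  profile_of_tents (by norm_num) (by norm_num) (by norm_num) (by norm_num)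

theorem greenSide_profile : Profile greenSide 5 6 1 :=
  profile_of_tents (by norm_num) (by norm_num) (by norm_num) (by norm_num)

theorem redSide_profile : Profile redSide 7 7 (-1) :=
  profile_of_tents (by norm_num) (by norm_num) (by norm_num) (by norm_num)

theorem selfProfile_profile : Profile selfProfile 8 8 (-1) :=
  profile_of_tents (by norm_num) (by norm_num) (by norm_num) (by norm_num)

theorem upProfile_profile : Profile upProfile 9 10 1 :=
  profile_of_tents (by norm_num) (by norm_num) (by norm_num) (by norm_num)

/-- The lateral sides are straight from 54 on, earlier than the common bound 58 in `Profile`. This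
frees the zone from 56 upwards, which the triangles of the upper side reach. -/
theorem purpleSide_eq_zero {y : ℝ} (hy : 54 ≤ y) : purpleSide y = 0 := by
  simp [purpleSide, tent_eq_zero_of_ge (show (16 : ℝ) < 19 by norm_num) (by linarith),
    tent_eq_zero_of_ge (show (48 : ℝ) < 52 by norm_num) (by linarith)]

theorem greenSide_eq_zero {y : ℝ} (hy : 54 ≤ y) : greenSide y = 0 := by
  simp [greenSide, tent_eq_zero_of_ge (show (16 : ℝ) < 21 by norm_num) (by linarith),
    tent_eq_zero_of_ge (show (48 : ℝ) < 54 by norm_num) (by linarith)]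

theorem redSide_eq_zero {y : ℝ} (hy : 54 ≤ y) : redSide y = 0 := by
  simp [redSide, tent_eq_zero_of_ge (show (16 : ℝ) < 23 by norm_num) (by linarith),
    tent_eq_zero_of_ge (show (48 : ℝ) < 50 by norm_num) (by linarith)]

theorem redSide_turn (y : ℝ) : redSide (64 - y) = -redSide y := by
  unfold redSide tent
  rw [min_comm, min_comm (((64 - y) - 41) / _)]
  ring_nf

theorem selfProfile_turn (x : ℝ) : selfProfile (64 - x) = -selfProfile x := by
  unfold selfProfile tent
  rw [min_comm, min_comm (((64 - x) - 40) / _)]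
  ring_nf

/-- Except at the apex over `16`, one may go in one direction without descending. -/
theorem Profile.exists_le {f : ℝ → ℝ} {d₁ d₂ : ℝ} {σ : ℤˣ} (h : Profile f d₁ d₂ σ) {x : ℝ}
    (hx : x ≠ 16) : ∃ τ : ℤˣ, ∃ ε > 0, ∀ t, 0 ≤ t → t ≤ ε →
      f x ≤ f (x + sgn τ * t) ∧ f x - 8 * t ≤ f (x - sgn τ * t) := by
  have hL : ∀ (τ : ℤˣ) t, 0 ≤ t → f x - 8 * t ≤ f (x - sgn τ * t) := by
    intro τ t ht
    have h1 := h.lipschitz x (x - sgn τ * t)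
    have h2 : |x - (x - sgn τ * t)| = t := by
      rcases Int.units_eq_one_or τ with rfl | rfl <;> simp [ht]
    rw [h2] at h1
    linarith [(abs_le.1 h1).2]
  rcases lt_or_gt_of_ne hx with h1 | h1
  · refine ⟨1, 16 - x, by linarith, fun t ht ht' => ⟨?_, hL _ t ht⟩⟩
    refine h.monotoneOn_Iic ?_ ?_ ?_ <;> simp <;> linarith
  · rcases le_or_gt x 48 with h2 | h2
    · refine ⟨-1, x - 16, by linarith, fun t ht ht' => ⟨?_, hL _ t ht⟩⟩
      refine h.antitoneOn_Icc ?_ ?_ ?_ <;> simp <;> (try constructor) <;> linarith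
    · refine ⟨1, 1, by linarith, fun t ht ht' => ⟨?_, hL _ t ht⟩⟩
      refine h.monotoneOn_Ici ?_ ?_ ?_ <;> simp <;> linarith

/-- Except at the apex over `48`, one may go in one direction without ascending. -/
theorem Profile.exists_ge {f : ℝ → ℝ} {d₁ d₂ : ℝ} {σ : ℤˣ} (h : Profile f d₁ d₂ σ) {x : ℝ}
    (hx : x ≠ 48) : ∃ τ : ℤˣ, ∃ ε > 0, ∀ t, 0 ≤ t → t ≤ ε →
      f (x + sgn τ * t) ≤ f x ∧ f (x - sgn τ * t) ≤ f x + 8 * t := by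
  have hL : ∀ (τ : ℤˣ) t, 0 ≤ t → f (x - sgn τ * t) ≤ f x + 8 * t := by
    intro τ t ht
    have h1 := h.lipschitz x (x - sgn τ * t)
    have h2 : |x - (x - sgn τ * t)| = t := by
      rcases Int.units_eq_one_or τ with rfl | rfl <;> simp [ht]
    rw [h2] at h1
    linarith [(abs_le.1 h1).1]
  rcases lt_or_gt_of_ne hx with h1 | h1
  · rcases lt_or_ge x 16 with h2 | h2
    · refine ⟨-1, 1, by linarith, fun t ht ht' => ⟨?_, hL _ t ht⟩⟩
      refine h.monotoneOn_Iic ?_ ?_ ?_ <;> simp <;> linarith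
    · refine ⟨1, 48 - x, by linarith, fun t ht ht' => ⟨?_, hL _ t ht⟩⟩
      refine h.antitoneOn_Icc ?_ ?_ ?_ <;> simp <;> (try constructor) <;> linarith
  · refine ⟨-1, x - 48, by linarith, fun t ht ht' => ⟨?_, hL _ t ht⟩⟩
    refine h.monotoneOn_Ici ?_ ?_ ?_ <;> simp <;> linarith

end

/-! ### Isometries, bumps and nicks in standard position -/

noncomputable section

theorem plane_ext {p q : Plane} (h0 : p 0 = q 0) (h1 : p 1 = q 1) : p = q := by
  ext i
  fin_cases i
  · exact h0
  · exact h1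

theorem plane_dist_eq (p q : Plane) :
    dist p q = √((p 0 - q 0) ^ 2 + (p 1 - q 1) ^ 2) := by
  rw [EuclideanSpace.dist_eq, Fin.sum_univ_two, Real.dist_eq, Real.dist_eq, sq_abs, sq_abs]

theorem sgn_sq (σ : ℤˣ) : sgn σ ^ 2 = 1 := by rw [sq, sgn_mul_self]

/-- A translation, possibly composed with reflections in the coordinate axes. -/
def signedIso (σ τ : ℤˣ) (a b : ℝ) : Plane ≃ᵢ Plane where
  toFun p := !₂[a + sgn σ * p 0, b + sgn τ * p 1]
  invFun p := !₂[sgn σ * (p 0 - a), sgn τ * (p 1 - b)]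
  left_inv p := plane_ext (by simp) (by simp)
  right_inv p := plane_ext (by simp) (by simp)
  isometry_toFun := by
    refine Isometry.of_dist_eq fun p q => ?_
    rw [plane_dist_eq, plane_dist_eq]
    simp only [Matrix.cons_val_zero, Matrix.cons_val_one,
      add_sub_add_left_eq_sub, ← mul_sub, mul_pow, sgn_sq, one_mul]

/-- The reflection in the diagonal. -/
def swapIso : Plane ≃ᵢ Plane where
  toFun p := !₂[p 1, p 0]
  invFun p := !₂[p 1, p 0]
  left_inv p := plane_ext (by simp) (by simp)
  right_inv p := plane_ext (by simp) (by simp)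
  isometry_toFun := by
    refine Isometry.of_dist_eq fun p q => ?_
    rw [plane_dist_eq, plane_dist_eq]
    simp [add_comm]

@[simp] theorem signedIso_apply_zero (σ τ : ℤˣ) (a b : ℝ) (p : Plane) :
    signedIso σ τ a b p 0 = a + sgn σ * p 0 := by simp [signedIso]

@[simp] theorem signedIso_apply_one (σ τ : ℤˣ) (a b : ℝ) (p : Plane) :
    signedIso σ τ a b p 1 = b + sgn τ * p 1 := by simp [signedIso]

@[simp] theorem swapIso_apply_zero (p : Plane) : swapIso p 0 = p 1 := by simp [swapIso]

@[simp] theorem swapIso_apply_one (p : Plane) : swapIso p 1 = p 0 := by simp [swapIso]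

/-- The prototiles. -/
inductive Kind : Type
  | purple : Kind
  | green : Kind
  | red : Kind

/-- The four sides of a square. -/
inductive Edge : Type
  | left : Edge
  | right : Edge
  | lower : Edge
  | upper : Edge

namespace Kind

def side : Kind → ℝ → ℝ
  | purple => purpleSide
  | green => greenSide
  | red => redSide

def low : Kind → ℝ → ℝ
  | purple => upProfile
  | green => selfProfile
  | red => selfProfile

def up : Kind → ℝ → ℝ
  | purple => upProfile
  | green => upProfile
  | red => selfProfile

def tile (k : Kind) : Set Plane := block k.side k.low k.up

/-- The type of the nick on the left side, and of the bump on the right side. -/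
def sideType₁ : Kind → ℝ
  | purple => 3
  | green => 5
  | red => 7

/-- The type of the bump on the left side, and of the nick on the right side. -/
def sideType₂ : Kind → ℝ
  | purple => 4
  | green => 6
  | red => 7

def sideSign : Kind → ℤˣ
  | purple => 1
  | green => 1
  | red => -1

/-- Along the lower side, as along the left one, the upward triangle of the profile is a nick and
the downward one a bump. Along the upper and the right side it is the other way round. -/
def lowType₁ : Kind → ℝ
  | purple => 9
  | green => 8
  | red => 8

def lowType₂ : Kind → ℝ
  | purple => 10
  | green => 8
  | red => 8

def lowSign : Kind → ℤˣ
  | purple => 1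
  | green => -1
  | red => -1

def upType₁ : Kind → ℝ
  | purple => 9
  | green => 9
  | red => 8

def upType₂ : Kind → ℝ
  | purple => 10
  | green => 10
  | red => 8

def upSign : Kind → ℤˣ
  | purple => 1
  | green => 1
  | red => -1

theorem side_profile : ∀ k : Kind, Profile k.side k.sideType₁ k.sideType₂ k.sideSign
  | purple => purpleSide_profile
  | green => greenSide_profile
  | red => redSide_profile

theorem low_profile : ∀ k : Kind, Profile k.low k.lowType₁ k.lowType₂ k.lowSign
  | purple => upProfile_profile
  | green => selfProfile_profile
  | red => selfProfile_profile

theorem up_profile : ∀ k : Kind, Profile k.up k.upType₁ k.upType₂ k.upSign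
  | purple => upProfile_profile
  | green => upProfile_profile
  | red => selfProfile_profile

theorem side_eq_zero (k : Kind) {y : ℝ} (hy : 54 ≤ y) : k.side y = 0 := by
  cases k
  · exact purpleSide_eq_zero hy
  · exact greenSide_eq_zero hy
  · exact redSide_eq_zero hy

/-- The type of the bump on a side of a prototile. -/
def bumpType (k : Kind) : Edge → ℝ
  | .left => k.sideType₂
  | .right => k.sideType₁
  | .lower => k.lowType₂
  | .upper => k.upType₁

/-- The type of the nick in a side of a prototile. -/
def nickType (k : Kind) : Edge → ℝ
  | .left => k.sideType₁
  | .right => k.sideType₂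
  | .lower => k.lowType₁
  | .upper => k.upType₂

/-- The isometry that maps the bump in standard position to the bump of the prototile. -/
def bumpIso (k : Kind) : Edge → Plane ≃ᵢ Plane
  | .left => swapIso.trans (signedIso (-1) k.sideSign (-8) 48)
  | .right => swapIso.trans (signedIso 1 1 72 16)
  | .lower => signedIso k.lowSign (-1) 48 (-8)
  | .upper => signedIso 1 1 16 72

/-- The isometry that maps the nick in standard position to the nick of the prototile. -/
def nickIso (k : Kind) : Edge → Plane ≃ᵢ Plane
  | .left => swapIso.trans (signedIso 1 1 8 16)
  | .right => swapIso.trans (signedIso (-1) k.sideSign 56 48)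
  | .lower => signedIso 1 1 16 8
  | .upper => signedIso k.upSign (-1) 48 56

theorem bumpType_mem (k : Kind) (e : Edge) : 3 ≤ k.bumpType e ∧ k.bumpType e ≤ 10 := by
  cases e
  exacts [k.side_profile.type₂, k.side_profile.type₁, k.low_profile.type₂, k.up_profile.type₁]

theorem nickType_mem (k : Kind) (e : Edge) : 3 ≤ k.nickType e ∧ k.nickType e ≤ 10 := by
  cases e
  exacts [k.side_profile.type₁, k.side_profile.type₂, k.low_profile.type₁, k.up_profile.type₂]

end Kind

/-- The angle with apex `0` that contains a bump in standard position. -/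
def wedge (d : ℝ) : Set Plane := {p | p 1 ≤ 4 * p 0 ∧ d * p 1 ≤ -8 * p 0}

def openWedge (d : ℝ) : Set Plane := {p | p 1 < 4 * p 0 ∧ d * p 1 < -8 * p 0}

/-- A neighbourhood of `0` that contains the bumps in standard position except for their bases. -/
def bumpBox : Set Plane := {p | -3 < p 0 ∧ p 0 < 7 ∧ -8 < p 1 ∧ p 1 < 1}

/-- `T` has a bump of type `d` in standard position. -/
def IsBump (d : ℝ) (T : Set Plane) : Prop := ∀ p ∈ bumpBox, p ∈ T ↔ p ∈ wedge d

/-- `T` has a nick of type `d` in standard position. -/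
def IsNick (d : ℝ) (T : Set Plane) : Prop := ∀ p ∈ bumpBox, p ∈ T ↔ p ∉ openWedge d

theorem sgn_mul_mem {σ : ℤˣ} {x : ℝ} (h : -3 < x) (h' : x < 7) :
    -7 < sgn σ * x ∧ sgn σ * x < 7 := by
  rcases Int.units_eq_one_or σ with rfl | rfl <;> simp <;> constructor <;> linarith

namespace Kind

/-- Near the apex only one of the four defining inequalities matters. Along a lateral side the
heights stay between 8 and 56, out of reach of the lower and upper curves; near the lower and upper
sides the lateral curves vanish. -/
theorem isBump (k : Kind) (e : Edge) : IsBump (k.bumpType e) (k.bumpIso e ⁻¹' k.tile) := by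
  rintro p ⟨h1, h2, h3, h4⟩
  have hd : 0 < k.bumpType e := by linarith [(k.bumpType_mem e).1]
  rw [wedge, Set.mem_ofPred_eq, ← le_spike_iff hd h3, Set.mem_preimage, tile, block,
    Set.mem_ofPred_eq]
  have hs := k.side_profile
  have hl := k.low_profile
  have hu := k.up_profile
  cases e
  · obtain ⟨h5, h6⟩ := sgn_mul_mem (σ := k.sideSign) h1 h2
    simp only [bumpIso, bumpType, IsometryEquiv.trans_apply, signedIso_apply_zero,
      signedIso_apply_one, swapIso_apply_zero, swapIso_apply_one, sgn_neg_one,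
      hs.near_down _ h1 h2]
    have := hl.le_eight (-8 + -1 * p 1)
    have := hu.neg_eight_le (-8 + -1 * p 1)
    have := hs.neg_eight_le (48 + sgn k.sideSign * p 0)
    rw [hs.near_down _ h1 h2] at this
    constructor
    · rintro ⟨h, -⟩
      linarith
    · intro h
      refine ⟨?_, ?_, ?_, ?_⟩ <;> linarith
  · simp only [bumpIso, bumpType, IsometryEquiv.trans_apply, signedIso_apply_zero,
      signedIso_apply_one, swapIso_apply_zero, swapIso_apply_one, sgn_one, one_mul,
      hs.near_up _ h1 h2]
    have := hl.le_eight (72 + p 1)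
    have := hu.neg_eight_le (72 + p 1)
    have := hs.le_eight (16 + p 0)
    rw [hs.near_up _ h1 h2] at this
    constructor
    · rintro ⟨-, h, -⟩
      linarith
    · intro h
      refine ⟨?_, ?_, ?_, ?_⟩ <;> linarith
  · obtain ⟨h5, h6⟩ := sgn_mul_mem (σ := k.lowSign) h1 h2
    simp only [bumpIso, bumpType, signedIso_apply_zero,
      signedIso_apply_one, sgn_neg_one, hl.near_down _ h1 h2,
      hs.eq_zero_left (-8 + -1 * p 1) (by linarith)]
    have := hl.neg_eight_le (48 + sgn k.lowSign * p 0)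
    rw [hl.near_down _ h1 h2] at this
    have := hu.neg_eight_le (48 + sgn k.lowSign * p 0)
    constructor
    · rintro ⟨-, -, h, -⟩
      linarith
    · intro h
      refine ⟨?_, ?_, ?_, ?_⟩ <;> linarith
  · simp only [bumpIso, bumpType, signedIso_apply_zero,
      signedIso_apply_one, sgn_one, one_mul, hu.near_up _ h1 h2,
      k.side_eq_zero (y := 72 + p 1) (by linarith)]
    have := hl.le_eight (16 + p 0)
    have := hu.le_eight (16 + p 0)
    rw [hu.near_up _ h1 h2] at this
    constructor
    · rintro ⟨-, -, -, h⟩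
      linarith
    · intro h
      refine ⟨?_, ?_, ?_, ?_⟩ <;> linarith

theorem isNick (k : Kind) (e : Edge) : IsNick (k.nickType e) (k.nickIso e ⁻¹' k.tile) := by
  rintro p ⟨h1, h2, h3, h4⟩
  have hd : 0 < k.nickType e := by linarith [(k.nickType_mem e).1]
  rw [openWedge, Set.mem_ofPred_eq, ← lt_spike_iff hd h3, Set.mem_preimage, tile, block,
    Set.mem_ofPred_eq, not_lt]
  have hs := k.side_profile
  have hl := k.low_profile
  have hu := k.up_profile
  cases e
  · simp only [nickIso, nickType, IsometryEquiv.trans_apply, signedIso_apply_zero,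
      signedIso_apply_one, swapIso_apply_zero, swapIso_apply_one, sgn_one, one_mul,
      hs.near_up _ h1 h2]
    have := hl.le_eight (8 + p 1)
    have := hu.neg_eight_le (8 + p 1)
    have := hs.neg_eight_le (16 + p 0)
    rw [hs.near_up _ h1 h2] at this
    constructor
    · rintro ⟨h, -⟩
      linarith
    · intro h
      refine ⟨?_, ?_, ?_, ?_⟩ <;> linarith
  · obtain ⟨h5, h6⟩ := sgn_mul_mem (σ := k.sideSign) h1 h2
    simp only [nickIso, nickType, IsometryEquiv.trans_apply, signedIso_apply_zero,
      signedIso_apply_one, swapIso_apply_zero, swapIso_apply_one, sgn_neg_one,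
      hs.near_down _ h1 h2]
    have := hl.le_eight (56 + -1 * p 1)
    have := hu.neg_eight_le (56 + -1 * p 1)
    have := hs.le_eight (48 + sgn k.sideSign * p 0)
    rw [hs.near_down _ h1 h2] at this
    constructor
    · rintro ⟨-, h, -⟩
      linarith
    · intro h
      refine ⟨?_, ?_, ?_, ?_⟩ <;> linarith
  · simp only [nickIso, nickType, signedIso_apply_zero,
      signedIso_apply_one, sgn_one, one_mul, hl.near_up _ h1 h2,
      hs.eq_zero_left (8 + p 1) (by linarith)]
    have := hu.neg_eight_le (16 + p 0)
    constructor
    · rintro ⟨-, -, h, -⟩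
      linarith
    · intro h
      refine ⟨?_, ?_, ?_, ?_⟩ <;> linarith
  · obtain ⟨h5, h6⟩ := sgn_mul_mem (σ := k.upSign) h1 h2
    simp only [nickIso, nickType, signedIso_apply_zero,
      signedIso_apply_one, sgn_neg_one, hu.near_down _ h1 h2,
      k.side_eq_zero (y := 56 + -1 * p 1) (by linarith)]
    have := hl.le_eight (48 + sgn k.upSign * p 0)
    constructor
    · rintro ⟨-, -, -, h⟩
      linarith
    · intro h
      refine ⟨?_, ?_, ?_, ?_⟩ <;> linarith

end Kind

/-- From the point `B` one can go within `T` in two directions that do not form an acute angle. -/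
def HasWideAngle (T : Set Plane) (B : Plane) : Prop :=
  ∃ u₀ u₁ v₀ v₁ : ℝ, (u₀ ≠ 0 ∨ u₁ ≠ 0) ∧ (v₀ ≠ 0 ∨ v₁ ≠ 0) ∧ u₀ * v₀ + u₁ * v₁ ≤ 0 ∧
    ∃ ε > 0, ∀ t, 0 ≤ t → t ≤ ε →
      !₂[B 0 + t * u₀, B 1 + t * u₁] ∈ T ∧ !₂[B 0 + t * v₀, B 1 + t * v₁] ∈ T

theorem mem_block_mk {s b u : ℝ → ℝ} {x y : ℝ} :
    (!₂[x, y] : Plane) ∈ block s b u ↔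
      s y ≤ x ∧ x ≤ 64 + s y ∧ b x ≤ y ∧ y ≤ 64 + u x := by
  simp [block]

theorem sgn_cases (τ : ℤˣ) : sgn τ = 1 ∨ sgn τ = -1 := by
  rcases Int.units_eq_one_or τ with rfl | rfl <;> simp

/-- Interior points offer two opposite directions and corners a right angle. At other boundary
points one follows the curve horizontally (or vertically) where it recedes from the tile, and goes
back along a line as steep as its Lipschitz constant. Only at a bump apex does the curve recede on
neither side. -/
theorem Kind.hasWideAngle (k : Kind) {B : Plane} (hB : B ∈ k.tile)
    (hB' : ∀ e, k.bumpIso e 0 ≠ B) : HasWideAngle k.tile B := by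
  have hs := k.side_profile
  have hl := k.low_profile
  have hu := k.up_profile
  obtain ⟨h1, h2, h3, h4⟩ := hB
  unfold HasWideAngle tile
  simp only [mem_block_mk]
  set x := B 0 with hx
  set y := B 1 with hy
  have key : ∀ e, k.bumpIso e 0 0 = x → k.bumpIso e 0 1 ≠ y :=
    fun e h0 h1 => hB' e (plane_ext h0 h1)
  have kL := key .left
  have kR := key .right
  have kD := key .lower
  have kU := key .upper
  simp only [bumpIso, IsometryEquiv.trans_apply, signedIso_apply_zero,
      signedIso_apply_one, swapIso_apply_zero, swapIso_apply_one, PiLp.zero_apply, mul_zero,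
      add_zero] at kL kR kD kU
  -- Up to height 14 the lateral sides are straight, so only the lower curve needs attention.
  rcases lt_or_ge y 10 with hy1 | hy1
  · have hs0 : ∀ z, z < 14 → k.side z = 0 := fun z hz => hs.eq_zero_left z hz.le
    rw [hs0 y (by linarith)] at h1 h2
    have hux : ∀ z, -8 ≤ k.up z := hu.neg_eight_le
    rcases h3.lt_or_eq with h3 | h3
    · refine ⟨0, 1, 0, -1, by norm_num, by norm_num, by norm_num,
        min 1 (y - k.low x), by simp [h3], fun t ht ht' => ?_⟩
      have ht1 := ht'.trans (min_le_left _ _)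
      have ht2 := ht'.trans (min_le_right _ _)
      rw [hs0 _ (by linarith), hs0 _ (by linarith)]
      simp only [mul_zero, add_zero]
      have := hux x
      refine ⟨⟨?_, ?_, ?_, ?_⟩, ⟨?_, ?_, ?_, ?_⟩⟩ <;> linarith
    · rcases eq_or_ne x 0 with h0 | h0
      · have hl0 : ∀ z, z < 14 → k.low z = 0 := fun z hz => hl.eq_zero_left z hz.le
        rw [h0, hl0 _ (by norm_num)] at h3
        refine ⟨1, 0, 0, 1, by norm_num, by norm_num, by norm_num, 1, by norm_num,
          fun t ht ht' => ?_⟩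
        rw [hs0 _ (by linarith), hs0 _ (by linarith), hl0 _ (by linarith), hl0 _ (by linarith)]
        have := hux (x + t * 1)
        have := hux (x + t * 0)
        refine ⟨⟨?_, ?_, ?_, ?_⟩, ⟨?_, ?_, ?_, ?_⟩⟩ <;> linarith
      · rcases eq_or_ne x 64 with h64 | h64
        · have hl0 : ∀ z, 58 < z → k.low z = 0 := fun z hz => hl.eq_zero_right z hz.le
          rw [h64, hl0 _ (by norm_num)] at h3
          refine ⟨-1, 0, 0, 1, by norm_num, by norm_num, by norm_num, 1, by norm_num,
            fun t ht ht' => ?_⟩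
          rw [hs0 _ (by linarith), hs0 _ (by linarith), hl0 _ (by linarith), hl0 _ (by linarith)]
          have := hux (x + t * -1)
          have := hux (x + t * 0)
          refine ⟨⟨?_, ?_, ?_, ?_⟩, ⟨?_, ?_, ?_, ?_⟩⟩ <;> linarith
        · have hx48 : x ≠ 48 := by
            intro h
            refine kD h.symm ?_
            have := hl.near_down 0 (by norm_num) (by norm_num)
            rw [mul_zero, add_zero] at this
            rw [← h3, h, this]
            simp [spike]
          obtain ⟨τ, ε, hε, h⟩ := hl.exists_ge hx48
          have hx0 : 0 < x := lt_of_le_of_ne h1 (Ne.symm h0)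
          have hx64 : x < 64 := lt_of_le_of_ne (by linarith) h64
          -- Monotonicity serves the horizontal direction, the Lipschitz constant 8 the steep one;
          -- their inner product is -1. The bound 1/10 keeps the height below 14.
          refine ⟨sgn τ, 0, -sgn τ, 8, ?_, by norm_num, ?_, min (min ε (1 / 10)) (min x (64 - x)),
            by simp [hε, hx0, hx64], fun t ht ht' => ?_⟩
          · rcases sgn_cases τ with h | h <;> rw [h] <;> norm_num
          · rcases sgn_cases τ with h | h <;> rw [h] <;> norm_num
          · have t1 := ht'.trans ((min_le_left _ _).trans (min_le_left _ _))
            have t2 := ht'.trans ((min_le_left _ _).trans (min_le_right _ _))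
            have t3 := ht'.trans ((min_le_right _ _).trans (min_le_left _ _))
            have t4 := ht'.trans ((min_le_right _ _).trans (min_le_right _ _))
            obtain ⟨h5, h5'⟩ := h t ht t1
            rw [show x + sgn τ * t = x + t * sgn τ by ring] at h5
            rw [hs0 _ (by linarith), hs0 _ (by linarith)]
            have := hux (x + t * sgn τ)
            have := hux (x + t * -sgn τ)
            rw [show x - sgn τ * t = x + t * -sgn τ by ring] at h5'
            have hτ := sgn_cases τ
            generalize sgn τ = c at *
            rcases hτ with rfl | rfl <;>
              refine ⟨⟨?_, ?_, ?_, ?_⟩, ⟨?_, ?_, ?_, ?_⟩⟩ <;> linarith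
  rcases lt_or_ge 54 y with hy2 | hy2
  · have hs0 : ∀ z, 54 ≤ z → k.side z = 0 := fun z hz => k.side_eq_zero hz
    rw [hs0 y (by linarith)] at h1 h2
    have hux : ∀ z, k.low z ≤ 8 := hl.le_eight
    rcases h4.lt_or_eq with h4 | h4
    · refine ⟨0, 1, 0, -1, by norm_num, by norm_num, by norm_num,
        min (y - 54) (64 + k.up x - y), by simp [h4, hy2], fun t ht ht' => ?_⟩
      have ht1 := ht'.trans (min_le_left _ _)
      have ht2 := ht'.trans (min_le_right _ _)
      rw [hs0 _ (by linarith), hs0 _ (by linarith)]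
      simp only [mul_zero, add_zero]
      have := hux x
      refine ⟨⟨?_, ?_, ?_, ?_⟩, ⟨?_, ?_, ?_, ?_⟩⟩ <;> linarith
    · rcases eq_or_ne x 0 with h0 | h0
      · have hl0 : ∀ z, z < 14 → k.up z = 0 := fun z hz => hu.eq_zero_left z hz.le
        rw [h0, hl0 _ (by norm_num)] at h4
        refine ⟨1, 0, 0, -1, by norm_num, by norm_num, by norm_num, 1, by norm_num,
          fun t ht ht' => ?_⟩
        rw [hs0 _ (by linarith), hs0 _ (by linarith), hl0 _ (by linarith), hl0 _ (by linarith)]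
        have := hux (x + t * 1)
        have := hux (x + t * 0)
        refine ⟨⟨?_, ?_, ?_, ?_⟩, ⟨?_, ?_, ?_, ?_⟩⟩ <;> linarith
      · rcases eq_or_ne x 64 with h64 | h64
        · have hl0 : ∀ z, 58 < z → k.up z = 0 := fun z hz => hu.eq_zero_right z hz.le
          rw [h64, hl0 _ (by norm_num)] at h4
          refine ⟨-1, 0, 0, -1, by norm_num, by norm_num, by norm_num, 1, by norm_num,
            fun t ht ht' => ?_⟩
          rw [hs0 _ (by linarith), hs0 _ (by linarith), hl0 _ (by linarith), hl0 _ (by linarith)]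
          have := hux (x + t * -1)
          have := hux (x + t * 0)
          refine ⟨⟨?_, ?_, ?_, ?_⟩, ⟨?_, ?_, ?_, ?_⟩⟩ <;> linarith
        · have hx16 : x ≠ 16 := by
            intro h
            refine kU h.symm ?_
            have := hu.near_up 0 (by norm_num) (by norm_num)
            rw [add_zero] at this
            rw [h4, h, this]
            norm_num [spike]
          obtain ⟨τ, ε, hε, h⟩ := hu.exists_le hx16
          have hx0 : 0 < x := lt_of_le_of_ne h1 (Ne.symm h0)
          have hx64 : x < 64 := lt_of_le_of_ne (by linarith) h64
          refine ⟨sgn τ, 0, -sgn τ, -8, ?_, by norm_num, ?_,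
            min (min ε ((y - 54) / 10)) (min x (64 - x)),
            by simp [hε, hx0, hx64, hy2], fun t ht ht' => ?_⟩
          · rcases sgn_cases τ with h | h <;> rw [h] <;> norm_num
          · rcases sgn_cases τ with h | h <;> rw [h] <;> norm_num
          · have t1 := ht'.trans ((min_le_left _ _).trans (min_le_left _ _))
            have t2 := ht'.trans ((min_le_left _ _).trans (min_le_right _ _))
            have t3 := ht'.trans ((min_le_right _ _).trans (min_le_left _ _))
            have t4 := ht'.trans ((min_le_right _ _).trans (min_le_right _ _))
            obtain ⟨h5, h5'⟩ := h t ht t1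
            rw [show x + sgn τ * t = x + t * sgn τ by ring] at h5
            rw [hs0 _ (by linarith), hs0 _ (by linarith)]
            have := hux (x + t * sgn τ)
            have := hux (x + t * -sgn τ)
            have := hu.neg_eight_le x
            rw [show x - sgn τ * t = x + t * -sgn τ by ring] at h5'
            have hτ := sgn_cases τ
            generalize sgn τ = c at *
            rcases hτ with rfl | rfl <;>
              refine ⟨⟨?_, ?_, ?_, ?_⟩, ⟨?_, ?_, ?_, ?_⟩⟩ <;> linarith
  -- Between heights 10 and 54 a step of height at most 1 cannot reach the lower and upper curves,
  -- and the lateral curve takes over the role played before by the horizontal ones.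
  have hlx : ∀ z, k.low z ≤ 8 := hl.le_eight
  have hux : ∀ z, -8 ≤ k.up z := hu.neg_eight_le
  rcases h1.lt_or_eq with h1 | h1
  · rcases h2.lt_or_eq with h2 | h2
    · refine ⟨1, 0, -1, 0, by norm_num, by norm_num, by norm_num,
        min (x - k.side y) (64 + k.side y - x), by simp [h1, h2], fun t ht ht' => ?_⟩
      have ht1 := ht'.trans (min_le_left _ _)
      have ht2 := ht'.trans (min_le_right _ _)
      simp only [mul_zero, add_zero]
      have := hux (x + t * 1)
      have := hux (x + t * -1)
      have := hlx (x + t * 1)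
      have := hlx (x + t * -1)
      refine ⟨⟨?_, ?_, ?_, ?_⟩, ⟨?_, ?_, ?_, ?_⟩⟩ <;> linarith
    · have hy16 : y ≠ 16 := by
        intro h
        refine kR ?_ h.symm
        have := hs.near_up 0 (by norm_num) (by norm_num)
        rw [add_zero] at this
        rw [h2, h, this]
        norm_num [spike]
      obtain ⟨τ, ε, hε, h⟩ := hs.exists_le hy16
      refine ⟨0, sgn τ, -8, -sgn τ, ?_, by norm_num, ?_, min ε 1,
        by simp [hε], fun t ht ht' => ?_⟩
      · rcases sgn_cases τ with h | h <;> rw [h] <;> norm_num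
      · rcases sgn_cases τ with h | h <;> rw [h] <;> norm_num
      · have t1 := ht'.trans (min_le_left _ _)
        have t2 := ht'.trans (min_le_right _ _)
        obtain ⟨h5, h5'⟩ := h t ht t1
        have h6 := hs.lipschitz y (y + sgn τ * t)
        have h7 := hs.lipschitz y (y - sgn τ * t)
        have h8 : |y - (y + sgn τ * t)| = t := by
          rcases sgn_cases τ with h | h <;> simp [h, ht]
        have h9 : |y - (y - sgn τ * t)| = t := by
          rcases sgn_cases τ with h | h <;> simp [h, ht]
        rw [h8] at h6
        rw [h9] at h7
        obtain ⟨h6, h6'⟩ := abs_le.1 h6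
        obtain ⟨h7, h7'⟩ := abs_le.1 h7
        have := hux (x + t * 0)
        have := hux (x + t * -8)
        have := hlx (x + t * 0)
        have := hlx (x + t * -8)
        rw [show y + sgn τ * t = y + t * sgn τ by ring] at h5 h6 h6'
        rw [show y - sgn τ * t = y + t * -sgn τ by ring] at h5' h7 h7'
        have hτ := sgn_cases τ
        generalize sgn τ = c at *
        rcases hτ with rfl | rfl <;>
          refine ⟨⟨?_, ?_, ?_, ?_⟩, ⟨?_, ?_, ?_, ?_⟩⟩ <;> linarith
  · have hy48 : y ≠ 48 := by
      intro h
      refine kL ?_ h.symm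
      have := hs.near_down 0 (by norm_num) (by norm_num)
      rw [mul_zero, add_zero] at this
      rw [← h1, h, this]
      simp [spike]
    obtain ⟨τ, ε, hε, h⟩ := hs.exists_ge hy48
    refine ⟨0, sgn τ, 8, -sgn τ, ?_, by norm_num, ?_, min ε 1,
      by simp [hε], fun t ht ht' => ?_⟩
    · rcases sgn_cases τ with h | h <;> rw [h] <;> norm_num
    · rcases sgn_cases τ with h | h <;> rw [h] <;> norm_num
    · have t1 := ht'.trans (min_le_left _ _)
      have t2 := ht'.trans (min_le_right _ _)
      obtain ⟨h5, h5'⟩ := h t ht t1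
      have h6 := hs.lipschitz y (y + sgn τ * t)
      have h7 := hs.lipschitz y (y - sgn τ * t)
      have h8 : |y - (y + sgn τ * t)| = t := by
        rcases sgn_cases τ with h | h <;> simp [h, ht]
      have h9 : |y - (y - sgn τ * t)| = t := by
        rcases sgn_cases τ with h | h <;> simp [h, ht]
      rw [h8] at h6
      rw [h9] at h7
      obtain ⟨h6, h6'⟩ := abs_le.1 h6
      obtain ⟨h7, h7'⟩ := abs_le.1 h7
      have := hux (x + t * 0)
      have := hux (x + t * 8)
      have := hlx (x + t * 0)
      have := hlx (x + t * 8)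
      rw [show y + sgn τ * t = y + t * sgn τ by ring] at h5 h6 h6'
      rw [show y - sgn τ * t = y + t * -sgn τ by ring] at h5' h7 h7'
      have hτ := sgn_cases τ
      generalize sgn τ = c at *
      rcases hτ with rfl | rfl <;>
        refine ⟨⟨?_, ?_, ?_, ?_⟩, ⟨?_, ?_, ?_, ?_⟩⟩ <;> linarith

end

/-! ### Angles that contain other angles -/

noncomputable section

/-- Twice the signed area of the triangle spanned by two vectors. -/
def cross (u v : Plane) : ℝ := u 0 * v 1 - u 1 * v 0

def dot (u v : Plane) : ℝ := u 0 * v 0 + u 1 * v 1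

theorem cross_swap (u v : Plane) : cross v u = -cross u v := by
  unfold cross
  ring

theorem dot_comm (u v : Plane) : dot v u = dot u v := by
  unfold dot
  ring

/-- Within an angle with sides `p`, `q`, the angle between two vectors is at most that between
`p` and `q`; the difference is made explicit. -/
theorem cross_dot_identity (p q u v : Plane) :
    cross p q * (dot u v * cross p q - cross u v * dot p q) =
      cross u q * cross v q * dot p p + cross p u * cross p v * dot q q +
        2 * (cross p u * cross v q * dot p q) := by
  unfold cross dot
  ring

/-- For positive `cross u v` this compares cotangents: an angle inside another one has the larger
cotangent. The form without division needs no sign of `cross u v`. -/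
theorem cross_mul_dot_le {p q u v : Plane} (hpq : 0 < cross p q) (hpq' : 0 ≤ dot p q)
    (hu : 0 ≤ cross u q) (hu' : 0 ≤ cross p u) (hv : 0 ≤ cross v q) (hv' : 0 ≤ cross p v) :
    cross u v * dot p q ≤ dot u v * cross p q := by
  have h := cross_dot_identity p q u v
  have hp : 0 ≤ dot p p := by unfold dot; nlinarith [sq_nonneg (p 0), sq_nonneg (p 1)]
  have hq : 0 ≤ dot q q := by unfold dot; nlinarith [sq_nonneg (q 0), sq_nonneg (q 1)]
  have h' : 0 ≤ cross p q * (dot u v * cross p q - cross u v * dot p q) := by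
    rw [h]
    positivity
  linarith [nonneg_of_mul_nonneg_right h' hpq]

/-- The vectors from the apex of a bump in standard position to its feet. -/
def shortLeg : Plane := !₂[-2, -8]

def longLeg (d : ℝ) : Plane := !₂[d, -8]

@[simp] theorem shortLeg_zero : shortLeg 0 = -2 := by simp [shortLeg]
@[simp] theorem shortLeg_one : shortLeg 1 = -8 := by simp [shortLeg]
@[simp] theorem longLeg_zero (d : ℝ) : longLeg d 0 = d := by simp [longLeg]
@[simp] theorem longLeg_one (d : ℝ) : longLeg d 1 = -8 := by simp [longLeg]

theorem mem_wedge_iff {d : ℝ} {u : Plane} :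
    u ∈ wedge d ↔ 0 ≤ cross shortLeg u ∧ 0 ≤ cross u (longLeg d) := by
  simp only [wedge, cross, Set.mem_ofPred_eq, shortLeg_zero, shortLeg_one, longLeg_zero,
    longLeg_one]
  constructor <;> rintro ⟨h1, h2⟩ <;> constructor <;> linarith

theorem cross_shortLeg_longLeg (d : ℝ) : cross shortLeg (longLeg d) = 8 * (d + 2) := by
  simp [cross]
  ring

theorem dot_shortLeg_longLeg (d : ℝ) : dot shortLeg (longLeg d) = 64 - 2 * d := by
  simp [dot]
  ring

theorem dot_shortLeg : dot shortLeg shortLeg = 68 := by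
  norm_num [dot]

theorem dot_longLeg (d : ℝ) : dot (longLeg d) (longLeg d) = 64 + d ^ 2 := by
  simp [dot]
  ring

/-- The vectors `u`, `v` have the same lengths and form the same angle as the legs of a bump of
type `d`. -/
structure IsLegs (d : ℝ) (u v : Plane) : Prop where
  short : dot u u = 68
  long : dot v v = 64 + d ^ 2
  mixed : dot u v = 64 - 2 * d

theorem IsLegs.cross_sq {d : ℝ} {u v : Plane} (h : IsLegs d u v) :
    cross u v = 8 * (d + 2) ∨ cross u v = -(8 * (d + 2)) := by
  have h1 : cross u v ^ 2 = (8 * (d + 2)) ^ 2 := by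
    have : cross u v ^ 2 = dot u u * dot v v - dot u v ^ 2 := by
      unfold cross dot
      ring
    rw [this, h.short, h.long, h.mixed]
    ring
  exact sq_eq_sq_iff_eq_or_eq_neg.1 h1

/-- The angle of type `d` has cotangent `(64 - 2 * d) / (8 * (d + 2))`. The comparison of cotangents
simplifies to `68 * d' ≤ 68 * d`. -/
theorem IsLegs.le {d d' : ℝ} (hd : 3 ≤ d ∧ d ≤ 10) {u v : Plane}
    (h : IsLegs d' u v) (hu : u ∈ wedge d) (hv : v ∈ wedge d) : d' ≤ d := by
  rw [mem_wedge_iff] at hu hv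
  have hc := cross_shortLeg_longLeg d
  have hc' := dot_shortLeg_longLeg d
  have h1 : 8 * (d' + 2) * (64 - 2 * d) ≤ (64 - 2 * d') * (8 * (d + 2)) := by
    rcases h.cross_sq with h2 | h2
    · have := cross_mul_dot_le (p := shortLeg) (q := longLeg d) (u := u) (v := v)
        (by rw [hc]; linarith [hd.1]) (by rw [hc']; linarith [hd.2]) hu.2 hu.1 hv.2 hv.1
      rwa [hc, hc', h2, h.mixed] at this
    · have := cross_mul_dot_le (p := shortLeg) (q := longLeg d) (u := v) (v := u)
        (by rw [hc]; linarith [hd.1]) (by rw [hc']; linarith [hd.2]) hv.2 hv.1 hu.2 hu.1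
      rwa [hc, hc', cross_swap, h2, dot_comm, h.mixed, neg_neg] at this
  linarith

theorem eq_smul_of_cross_eq_zero {u w : Plane} (hw : 0 < dot w w) (h : cross u w = 0) :
    u = (dot u w / dot w w) • w := by
  have hw' := hw.ne'
  unfold cross dot at *
  refine plane_ext ?_ ?_ <;>
    rw [PiLp.smul_apply, smul_eq_mul, div_mul_eq_mul_div, eq_div_iff hw']
  · linear_combination w 1 * h
  · linear_combination -w 0 * h

theorem dot_smul_smul (a b : ℝ) (u v : Plane) : dot (a • u) (b • v) = a * b * dot u v := by
  simp only [dot, PiLp.smul_apply, smul_eq_mul]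
  ring

/-- If the legs of a bump of type `d` lie in the angle of a bump of type `d`, then they are the
legs of the latter, or interchange their directions. -/
theorem IsLegs.eq_or_swap {d : ℝ} (hd : 3 ≤ d ∧ d ≤ 10) {u v : Plane}
    (h : IsLegs d u v) (hu : u ∈ wedge d) (hv : v ∈ wedge d) :
    (u = shortLeg ∧ v = longLeg d) ∨
      ∃ a c : ℝ, 0 < a ∧ 0 < c ∧ a * c = 1 ∧ c ^ 2 * (64 + d ^ 2) = 68 ∧
        u = c • longLeg d ∧ v = a • shortLeg := by
  rw [mem_wedge_iff] at hu hv
  have hc := cross_shortLeg_longLeg d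
  have hc' := dot_shortLeg_longLeg d
  have hpp := dot_shortLeg
  have hqq := dot_longLeg d
  have hqq' : 0 < dot (longLeg d) (longLeg d) := by rw [hqq]; positivity
  have main : ∀ u v : Plane, (0 ≤ cross shortLeg u ∧ 0 ≤ cross u (longLeg d)) →
      (0 ≤ cross shortLeg v ∧ 0 ≤ cross v (longLeg d)) → cross u v = 8 * (d + 2) →
      dot u v = 64 - 2 * d →
      (∃ a : ℝ, u = a • shortLeg) ∧ ∃ c : ℝ, v = c • longLeg d := by
    intro u v hu hv h1 h2
    -- Equal angles make the left side of the identity vanish, so each of the three nonnegative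
    -- terms on the right is zero; this forces each vector onto a side of the angle.
    have e := cross_dot_identity shortLeg (longLeg d) u v
    rw [hc, hc', h1, h2, hpp, hqq, mul_comm (8 * (d + 2)) (64 - 2 * d), sub_self, mul_zero] at e
    have e1 : 0 ≤ cross u (longLeg d) * cross v (longLeg d) := mul_nonneg hu.2 hv.2
    have e2 : 0 ≤ cross shortLeg u * cross shortLeg v := mul_nonneg hu.1 hv.1
    have e3 : 0 ≤ cross shortLeg u * cross v (longLeg d) := mul_nonneg hu.1 hv.2
    have e2' : 0 ≤ cross shortLeg u * cross shortLeg v * (64 + d ^ 2) := by positivity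
    have e3' : 0 ≤ cross shortLeg u * cross v (longLeg d) * (64 - 2 * d) :=
      mul_nonneg e3 (by linarith [hd.2])
    have e4 : cross u (longLeg d) * cross v (longLeg d) = 0 := by linarith
    have e5 : cross shortLeg u * cross shortLeg v * (64 + d ^ 2) = 0 := by linarith
    have e5 : cross shortLeg u * cross shortLeg v = 0 := by
      rcases mul_eq_zero.1 e5 with h | h
      · exact h
      · nlinarith
    have e6 : cross shortLeg u * cross v (longLeg d) * (64 - 2 * d) = 0 := by linarith
    have e6 : cross shortLeg u * cross v (longLeg d) = 0 := by
      rcases mul_eq_zero.1 e6 with h | h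
      · exact h
      · linarith [hd.2]
    have expand : cross shortLeg (longLeg d) * cross u v =
        cross u (longLeg d) * cross shortLeg v - cross shortLeg u * cross v (longLeg d) := by
      unfold cross
      ring
    rw [hc, h1, e6, sub_zero] at expand
    have hpos : 0 < 8 * (d + 2) * (8 * (d + 2)) := by
      have := hd.1
      positivity
    have n1 : cross u (longLeg d) ≠ 0 := fun h => by rw [h, zero_mul] at expand; linarith
    have n2 : cross shortLeg v ≠ 0 := fun h => by rw [h, mul_zero] at expand; linarith
    have z1 : cross v (longLeg d) = 0 := (mul_eq_zero.1 e4).resolve_left n1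
    have z2 : cross shortLeg u = 0 := (mul_eq_zero.1 e5).resolve_right n2
    exact ⟨⟨_, eq_smul_of_cross_eq_zero (by rw [hpp]; norm_num) (by rw [cross_swap, z2, neg_zero])⟩,
      ⟨_, eq_smul_of_cross_eq_zero hqq' z1⟩⟩
  rcases h.cross_sq with h2 | h2
  · left
    obtain ⟨⟨a, rfl⟩, ⟨c, rfl⟩⟩ := main u v hu hv h2 h.mixed
    have h3 := h.short
    have h4 := h.long
    have h5 := h.mixed
    rw [dot_smul_smul, hpp] at h3
    rw [dot_smul_smul, hqq] at h4
    rw [dot_smul_smul, hc'] at h5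
    have h6 : a * c = 1 := by
      refine mul_right_cancel₀ (b := 64 - 2 * d) (by linarith [hd.2] : (64 - 2 * d) ≠ 0) ?_
      linarith
    have h7 : 0 ≤ a := by
      have := hu.2
      simp only [cross, PiLp.smul_apply, smul_eq_mul, shortLeg_zero, shortLeg_one, longLeg_zero,
        longLeg_one] at this
      nlinarith [hd.1]
    have h8 : a = 1 := by nlinarith
    subst h8
    have h9 : c = 1 := by linarith
    subst h9
    simp
  · right
    obtain ⟨⟨a, rfl⟩, ⟨c, rfl⟩⟩ := main v u hv hu (by rw [cross_swap, h2, neg_neg])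
      (by rw [dot_comm, h.mixed])
    have h3 := h.short
    have h5 := h.mixed
    rw [dot_smul_smul, hqq] at h3
    rw [dot_smul_smul, dot_comm, hc'] at h5
    have h6 : a * c = 1 := by
      refine mul_right_cancel₀ (b := 64 - 2 * d) (by linarith [hd.2] : (64 - 2 * d) ≠ 0) ?_
      linarith
    have h7 : 0 ≤ a := by
      have := hv.2
      simp only [cross, PiLp.smul_apply, smul_eq_mul, shortLeg_zero, shortLeg_one, longLeg_zero,
        longLeg_one] at this
      nlinarith [hd.1]
    have h8 : 0 < a := lt_of_le_of_ne h7 (by rintro rfl; simp at h6)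
    refine ⟨a, c, h8, ?_, h6, by linarith, rfl, rfl⟩
    exact (pos_iff_pos_of_mul_pos (by rw [h6]; norm_num)).1 h8

/-- A direction that lies within every angle of a bump that is contained in the angle of another
bump. -/
def middle : Plane := !₂[1, -3]

@[simp] theorem middle_zero : middle 0 = 1 := by simp [middle]
@[simp] theorem middle_one : middle 1 = -3 := by simp [middle]

/-- `middle` splits the angle of type `d` into parts with tangents `14 / 22` and `(3 * d - 8) / (d +
24) ≤ 22 / 34`. Both are below `40 / 58`, the tangent for type 3, so no bump angle fits into one
part: its legs lie strictly on different sides of `middle`. -/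
theorem IsLegs.middle_mem {d d' : ℝ} (hd : 3 ≤ d ∧ d ≤ 10) (hd' : 3 ≤ d' ∧ d' ≤ 10)
    {u v : Plane} (h : IsLegs d' u v) (hu : u ∈ wedge d) (hv : v ∈ wedge d) :
    ∃ a b : ℝ, 0 < a ∧ 0 < b ∧ middle = a • u + b • v := by
  rw [mem_wedge_iff] at hu hv
  have c1 : cross shortLeg middle = 14 := by norm_num [cross]
  have c2 : dot shortLeg middle = 22 := by norm_num [dot]
  have c3 : cross middle (longLeg d) = 3 * d - 8 := by simp [cross]; ring
  have c4 : dot middle (longLeg d) = d + 24 := by simp [dot]; ring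
  have c5 := cross_shortLeg_longLeg d
  have main : ∀ u v : Plane, (0 ≤ cross shortLeg u ∧ 0 ≤ cross u (longLeg d)) →
      (0 ≤ cross shortLeg v ∧ 0 ≤ cross v (longLeg d)) → cross u v = 8 * (d' + 2) →
      dot u v = 64 - 2 * d' → 0 < cross u middle ∧ 0 < cross middle v := by
    intro u v hu hv h1 h2
    constructor
    · by_contra! hneg
      have hmu : 0 ≤ cross middle u := by rw [cross_swap]; linarith
      -- If `u` is not before `middle`, then neither is `v`, which follows `u` counterclockwise; so
      -- both would lie in the part next to the long leg.
      have hmv : 0 ≤ cross middle v := by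
        by_contra! hneg'
        have e' : cross middle (longLeg d) * cross u v =
          cross u (longLeg d) * cross middle v - cross middle u * cross v (longLeg d) := by
          unfold cross
          ring
        rw [c3, h1] at e'
        have : 0 < (3 * d - 8) * (8 * (d' + 2)) :=
          mul_pos (by linarith [hd.1]) (by linarith [hd'.1])
        nlinarith [mul_nonneg hu.2 (neg_nonneg.2 hneg'.le), mul_nonneg hmu hv.2]
      have := cross_mul_dot_le (p := middle) (q := longLeg d) (u := u) (v := v)
        (by rw [c3]; linarith [hd.1]) (by rw [c4]; linarith [hd.1]) hu.2 hmu hv.2 hmv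
      rw [c3, c4, h1, h2] at this
      nlinarith [mul_nonneg (sub_nonneg.2 hd'.1) (sub_nonneg.2 hd.1)]
    · by_contra! hneg
      have hvm : 0 ≤ cross v middle := by rw [cross_swap]; linarith
      have hum : 0 ≤ cross u middle := by
        by_contra! hneg'
        have e' : cross shortLeg middle * cross u v =
          cross u middle * cross shortLeg v - cross shortLeg u * cross v middle := by
          unfold cross
          ring
        rw [c1, h1] at e'
        have := hd'.1
        nlinarith [mul_nonneg hv.1 (neg_nonneg.2 hneg'.le), mul_nonneg hu.1 hvm]
      have := cross_mul_dot_le (p := shortLeg) (q := middle) (u := u) (v := v)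
        (by rw [c1]; norm_num) (by rw [c2]; norm_num) hum hu.1 hvm hv.1
      rw [c1, c2, h1, h2] at this
      linarith [hd'.1]
  have expand : cross u v ≠ 0 → middle =
      (cross middle v / cross u v) • u + (cross u middle / cross u v) • v := by
    intro hne
    refine plane_ext ?_ ?_ <;>
      simp only [PiLp.add_apply, PiLp.smul_apply, smul_eq_mul] <;> field_simp <;>
      unfold cross <;> ring
  have hpos : 0 < 8 * (d' + 2) := by linarith [hd'.1]
  rcases h.cross_sq with h2 | h2
  · obtain ⟨m1, m2⟩ := main u v hu hv h2 h.mixed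
    exact ⟨_, _, div_pos m2 (h2 ▸ hpos), div_pos m1 (h2 ▸ hpos), expand (h2 ▸ hpos.ne')⟩
  · obtain ⟨m1, m2⟩ := main v u hv hu (by rw [cross_swap, h2, neg_neg]) (by rw [dot_comm, h.mixed])
    rw [cross_swap] at m1 m2
    have hneg : cross u v < 0 := by rw [h2]; linarith
    exact ⟨_, _, div_pos_of_neg_of_neg (by linarith) hneg,
      div_pos_of_neg_of_neg (by linarith) hneg, expand hneg.ne⟩

end

/-! ### Rigidity of a bump in a nick -/

noncomputable section

open Topology in
theorem exists_smul_mem {N : Set Plane} (hN : N ∈ 𝓝 (0 : Plane)) (u : Plane) :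
    ∃ ε > 0, ∀ t : ℝ, 0 ≤ t → t ≤ ε → t • u ∈ N := by
  have h : Filter.Tendsto (fun t : ℝ => t • u) (𝓝 0) (𝓝 0) := by
    have : Continuous fun t : ℝ => t • u := by fun_prop
    simpa using this.tendsto 0
  obtain ⟨ε, hε, h'⟩ := Metric.eventually_nhds_iff.1 (h.eventually hN)
  refine ⟨ε / 2, by linarith, fun t ht ht' => h' ?_⟩
  rw [Real.dist_eq, sub_zero, abs_of_nonneg ht]
  linarith

theorem isOpen_bumpBox : IsOpen bumpBox :=
  (isOpen_lt (by fun_prop) (by fun_prop)).and <| (isOpen_lt (by fun_prop) (by fun_prop)).and <|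
    (isOpen_lt (by fun_prop) (by fun_prop)).and (isOpen_lt (by fun_prop) (by fun_prop))

theorem isOpen_openWedge (d : ℝ) : IsOpen (openWedge d) :=
  (isOpen_lt (by fun_prop) (by fun_prop)).and (isOpen_lt (by fun_prop) (by fun_prop))

theorem isClosed_wedge (d : ℝ) : IsClosed (wedge d) :=
  (isClosed_le (by fun_prop) (by fun_prop)).and (isClosed_le (by fun_prop) (by fun_prop))

theorem openWedge_subset_wedge (d : ℝ) : openWedge d ⊆ wedge d := fun _ h => ⟨h.1.le, h.2.le⟩

theorem zero_mem_bumpBox : (0 : Plane) ∈ bumpBox := by norm_num [bumpBox]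

theorem zero_mem_wedge (d : ℝ) : (0 : Plane) ∈ wedge d := by simp [wedge]

theorem bumpBox_mem_nhds : bumpBox ∈ nhds (0 : Plane) := isOpen_bumpBox.mem_nhds zero_mem_bumpBox

theorem smul_mem_wedge_iff {d t : ℝ} (ht : 0 < t) {u : Plane} :
    t • u ∈ wedge d ↔ u ∈ wedge d := by
  simp only [wedge, Set.mem_ofPred_eq, PiLp.smul_apply, smul_eq_mul]
  rw [show 4 * (t * u 0) = t * (4 * u 0) by ring, show d * (t * u 1) = t * (d * u 1) by ring,
    show -8 * (t * u 0) = t * (-8 * u 0) by ring, mul_le_mul_iff_right₀ ht,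
    mul_le_mul_iff_right₀ ht]

theorem smul_mem_openWedge_iff {d t : ℝ} (ht : 0 < t) {u : Plane} :
    t • u ∈ openWedge d ↔ u ∈ openWedge d := by
  simp only [openWedge, Set.mem_ofPred_eq, PiLp.smul_apply, smul_eq_mul]
  rw [show 4 * (t * u 0) = t * (4 * u 0) by ring, show d * (t * u 1) = t * (d * u 1) by ring,
    show -8 * (t * u 0) = t * (-8 * u 0) by ring, mul_lt_mul_iff_right₀ ht,
    mul_lt_mul_iff_right₀ ht]

theorem inner_eq_dot (u v : Plane) : inner ℝ u v = dot u v := by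
  rw [PiLp.inner_apply, Fin.sum_univ_two, dot]
  simp
  ring

theorem eq_combination {d : ℝ} (hd : 0 < d + 2) (p : Plane) :
    p = (cross p (longLeg d) / (8 * (d + 2))) • shortLeg +
      (cross shortLeg p / (8 * (d + 2))) • longLeg d := by
  refine plane_ext ?_ ?_ <;>
    simp only [PiLp.add_apply, PiLp.smul_apply, smul_eq_mul, cross, shortLeg_zero, shortLeg_one,
      longLeg_zero, longLeg_one] <;> field_simp <;> ring

/-- The angle is acute: its legs have the positive inner product `64 - 2 * d`, and its nonzero
elements are nonnegative combinations of them. -/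
theorem dot_pos_of_mem_wedge {d : ℝ} (hd : 3 ≤ d ∧ d ≤ 10) {u v : Plane} (hu : u ∈ wedge d)
    (hv : v ∈ wedge d) (hu' : u ≠ 0) (hv' : v ≠ 0) : 0 < dot u v := by
  rw [mem_wedge_iff] at hu hv
  have hd2 : 0 < d + 2 := by linarith [hd.1]
  have key : ∀ w : Plane, 0 ≤ cross shortLeg w ∧ 0 ≤ cross w (longLeg d) → w ≠ 0 →
      0 < cross shortLeg w + cross w (longLeg d) := by
    intro w h h0
    refine lt_of_le_of_ne (add_nonneg h.1 h.2) fun h1 => h0 ?_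
    rw [eq_combination hd2 w, show cross shortLeg w = 0 by linarith [h.1, h.2],
      show cross w (longLeg d) = 0 by linarith [h.1, h.2]]
    simp
  have e : (8 * (d + 2)) ^ 2 * dot u v =
      cross u (longLeg d) * cross v (longLeg d) * 68 +
      cross shortLeg u * cross shortLeg v * (64 + d ^ 2) +
      (cross u (longLeg d) * cross shortLeg v + cross shortLeg u * cross v (longLeg d)) *
        (64 - 2 * d) := by
    simp only [cross, dot, shortLeg_zero, shortLeg_one, longLeg_zero, longLeg_one]
    ring
  have p := mul_pos (key u hu hu') (key v hv hv')
  have q1 := mul_nonneg hu.2 hv.2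
  have q2 := mul_nonneg hu.1 hv.1
  have q3 := mul_nonneg hu.2 hv.1
  have q4 := mul_nonneg hu.1 hv.2
  have q5 : 0 ≤ cross shortLeg u * cross shortLeg v * d ^ 2 := by positivity
  have q6 := mul_nonneg (add_nonneg q3 q4) (show 0 ≤ 10 - d by linarith [hd.2])
  have : 0 < (8 * (d + 2)) ^ 2 * dot u v := by
    rw [e]
    nlinarith
  exact (pos_iff_pos_of_mul_pos this).1 (by positivity)

/-- `T` contains the bump of type `d` in standard position near its apex, and does not leave it
except through the base. -/
structure Fills (d : ℝ) (T : Set Plane) : Prop where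
  subset : ∀ p ∈ bumpBox, p ∈ T → p ∈ wedge d
  near : ∃ ε > 0, ∀ p ∈ wedge d, dist p 0 < ε → p ∈ T

theorem IsBump.fills {d : ℝ} {T : Set Plane} (h : IsBump d T) : Fills d T := by
  refine ⟨fun p hp hpT => (h p hp).1 hpT, ?_⟩
  obtain ⟨ε, hε, h'⟩ := Metric.mem_nhds_iff.1 bumpBox_mem_nhds
  exact ⟨ε, hε, fun p hp hpε => (h p (h' hpε)).2 hp⟩

theorem Fills.zero_mem {d : ℝ} {T : Set Plane} (h : Fills d T) : 0 ∈ T := by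
  obtain ⟨ε, hε, h'⟩ := h.near
  exact h' 0 (zero_mem_wedge d) (by simpa using hε)

theorem dot_map (χ : Plane ≃ₗᵢ[ℝ] Plane) (u v : Plane) : dot (χ u) (χ v) = dot u v := by
  rw [← inner_eq_dot, ← inner_eq_dot, χ.inner_map_map]

theorem isLegs_map (χ : Plane ≃ₗᵢ[ℝ] Plane) (d : ℝ) :
    IsLegs d (χ shortLeg) (χ (longLeg d)) :=
  ⟨by rw [dot_map, dot_shortLeg], by rw [dot_map, dot_longLeg],
    by rw [dot_map, dot_shortLeg_longLeg]⟩

theorem shortLeg_mem_wedge {d : ℝ} (hd : 0 ≤ d + 2) : shortLeg ∈ wedge d := by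
  rw [mem_wedge_iff, cross_shortLeg_longLeg]
  refine ⟨by simp [cross, mul_comm], by linarith⟩

theorem longLeg_mem_wedge {d : ℝ} (hd : 0 ≤ d + 2) : longLeg d ∈ wedge d := by
  rw [mem_wedge_iff, cross_shortLeg_longLeg]
  refine ⟨by linarith, by simp [cross]; linarith⟩

/-- Angles are cones, so inclusion near the apex passes to all vectors by scaling into the box and
back. -/
theorem map_mem_wedge {d d' : ℝ} {T : Set Plane} (hT : IsBump d' T) (χ : Plane ≃ₗᵢ[ℝ] Plane)
    (h : ∀ p ∈ bumpBox, p ∈ χ '' T → p ∈ wedge d) {u : Plane} (hu : u ∈ wedge d') :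
    χ u ∈ wedge d := by
  obtain ⟨ε, hε, h1⟩ := exists_smul_mem bumpBox_mem_nhds u
  obtain ⟨ε', hε', h2⟩ := exists_smul_mem bumpBox_mem_nhds (χ u)
  have hpos : 0 < min ε ε' := lt_min hε hε'
  have h3 := h1 _ hpos.le (min_le_left _ _)
  have h4 := h2 _ hpos.le (min_le_right _ _)
  rw [← smul_mem_wedge_iff hpos]
  refine h _ h4 ⟨_, (hT _ h3).2 ((smul_mem_wedge_iff hpos).2 hu), ?_⟩
  simp

theorem symm_map_mem_wedge {d d' : ℝ} {T : Set Plane} (hT : IsBump d' T)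
    (χ : Plane ≃ₗᵢ[ℝ] Plane) (h : Fills d (χ '' T)) {u : Plane} (hu : u ∈ wedge d) :
    χ.symm u ∈ wedge d' := by
  obtain ⟨r, hr, h'⟩ := h.near
  obtain ⟨ε, hε, h1⟩ := exists_smul_mem bumpBox_mem_nhds (χ.symm u)
  obtain ⟨ε', hε', h2⟩ := exists_smul_mem (Metric.ball_mem_nhds (0 : Plane) hr) u
  have hpos : 0 < min ε ε' := lt_min hε hε'
  have h3 := h1 _ hpos.le (min_le_left _ _)
  have h4 := h2 _ hpos.le (min_le_right _ _)
  obtain ⟨q, hq, hq'⟩ := h' _ ((smul_mem_wedge_iff hpos).2 hu) h4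
  rw [← smul_mem_wedge_iff hpos]
  refine (hT _ h3).1 ?_
  have : q = min ε ε' • χ.symm u := by
    apply χ.injective
    rw [hq']
    simp
  rwa [← this]

/-- Inclusion of the angles both ways gives equal types. The isometry then fixes the legs, hence
every point, or interchanges their directions; `hfoot` rules out the second case. -/
theorem Fills.eq_refl {d d' : ℝ} (hd : 3 ≤ d ∧ d ≤ 10) (hd' : 3 ≤ d' ∧ d' ≤ 10) {T : Set Plane}
    (hT : IsBump d' T) (hfoot : ∀ t : ℝ, 0 ≤ t → t < 1 → !₂[-2 - t, -8] ∈ T)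
    (χ : Plane ≃ₗᵢ[ℝ] Plane) (h : Fills d (χ '' T)) : d' = d ∧ ∀ p, χ p = p := by
  have hu := map_mem_wedge hT χ h.subset (shortLeg_mem_wedge (by linarith [hd'.1]))
  have hv := map_mem_wedge hT χ h.subset (longLeg_mem_wedge (by linarith [hd'.1]))
  have hu' := symm_map_mem_wedge hT χ h (shortLeg_mem_wedge (by linarith [hd.1]))
  have hv' := symm_map_mem_wedge hT χ h (longLeg_mem_wedge (by linarith [hd.1]))
  obtain rfl : d' = d := le_antisymm ((isLegs_map χ d').le hd hu hv)
    ((isLegs_map χ.symm d).le hd' hu' hv')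
  refine ⟨rfl, ?_⟩
  rcases (isLegs_map χ d').eq_or_swap hd hu hv with ⟨h1, h2⟩ | ⟨a, c, ha, hc, hac, hc2, h1, h2⟩
  · intro p
    have := eq_combination (d := d') (by linarith [hd.1]) p
    generalize cross p (longLeg d') / (8 * (d' + 2)) = α at this
    generalize cross shortLeg p / (8 * (d' + 2)) = β at this
    rw [this, map_add, map_smul, map_smul, h1, h2]
  · exfalso
    -- These bounds follow from `c ^ 2 * (64 + d' ^ 2) = 68` with `3 ≤ d' ≤ 10`. They put the test
    -- point below into the box; in particular `c < 1`, since the long leg is the longer one, so the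
    -- image of the short foot stays above the base.
    have c1 : c ≤ 97 / 100 := by
      by_contra! hlt
      have h3 : (97 / 100) ^ 2 < c ^ 2 := by nlinarith
      have h4 : 9 ≤ d' ^ 2 := by nlinarith [hd.1]
      nlinarith
    have c2 : 3 / 5 ≤ c := by
      by_contra! hlt
      have : c ^ 2 < 9 / 25 := by nlinarith
      have : d' ^ 2 ≤ 100 := by nlinarith [hd.1, hd.2]
      nlinarith
    have c3 : a ≤ 5 / 3 := by
      by_contra! hlt
      nlinarith
    have c4 : c * d' ≤ 13 / 2 := by
      by_contra! hlt
      have : (13 / 2) ^ 2 < (c * d') ^ 2 := by nlinarith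
      have : c ^ 2 ≥ 68 / 164 := by
        have : d' ^ 2 ≤ 100 := by nlinarith [hd.1, hd.2]
        nlinarith [sq_nonneg c]
      nlinarith
    -- A point of the straight side just beyond the short foot. This distance gives it the
    -- coefficients 1001/1000 and -1/1000 in the legs; the negative one sends its image outside the
    -- angle.
    have hfoot' := hfoot ((d' + 2) / 1000) (by linarith [hd.1]) (by linarith [hd.2])
    have e : (!₂[-2 - (d' + 2) / 1000, -8] : Plane) =
        (1001 / 1000 : ℝ) • shortLeg - (1 / 1000 : ℝ) • longLeg d' := by
      refine plane_ext ?_ ?_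
      · simp
        ring
      · simp
        norm_num
    have himg := Set.mem_image_of_mem χ hfoot'
    rw [e, map_sub, map_smul, map_smul, h1, h2] at himg
    have hcd : 0 < c * d' := mul_pos hc (by linarith [hd.1])
    have hbox := h.subset _ (by
      simp only [bumpBox, Set.mem_ofPred_eq, PiLp.sub_apply, PiLp.smul_apply, smul_eq_mul,
        shortLeg_zero, shortLeg_one, longLeg_zero, longLeg_one]
      refine ⟨?_, ?_, ?_, ?_⟩ <;> linarith) himg
    simp only [wedge, Set.mem_ofPred_eq, PiLp.sub_apply, PiLp.smul_apply, smul_eq_mul,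
        shortLeg_zero, shortLeg_one, longLeg_zero, longLeg_one] at hbox
    have : 0 < a * (d' + 2) := mul_pos ha (by linarith [hd.1])
    linarith [hbox.2]

namespace Kind

/-- Beyond the foot of the short leg the side goes on straight; this breaks the mirror symmetry of
the bump's angle. -/
theorem foot_mem (k : Kind) (e : Edge) (t : ℝ) (ht : 0 ≤ t) (ht' : t < 1) :
    !₂[-2 - t, -8] ∈ k.bumpIso e ⁻¹' k.tile := by
  have spike_zero : ∀ d, spike d (-2 - t) = 0 := by
    intro d
    exact max_eq_left ((min_le_left _ _).trans (by linarith))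
  have hs := k.side_profile
  have hl := k.low_profile
  have hu := k.up_profile
  have h1 : -3 < -2 - t := by linarith
  have h2 : -2 - t < 7 := by linarith
  rw [Set.mem_preimage, tile, block, Set.mem_ofPred_eq]
  cases e
  · obtain ⟨h5, h6⟩ := sgn_mul_mem (σ := k.sideSign) h1 h2
    have := hs.near_down _ h1 h2
    rw [spike_zero] at this
    simp [bumpIso, this, hl.eq_zero_left, hu.eq_zero_left]
    constructor <;> linarith
  · have := hs.near_up _ h1 h2
    rw [spike_zero] at this
    simp [bumpIso, this]
    norm_num [hl.eq_zero_right, hu.eq_zero_right]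
    constructor <;> linarith
  · obtain ⟨h5, h6⟩ := sgn_mul_mem (σ := k.lowSign) h1 h2
    have := hl.near_down _ h1 h2
    rw [spike_zero] at this
    simp [bumpIso, this, hs.eq_zero_left]
    have := hu.neg_eight_le (48 + sgn k.lowSign * (-2 - t))
    refine ⟨?_, ?_, ?_⟩ <;> linarith
  · have := hu.near_up _ h1 h2
    rw [spike_zero] at this
    simp [bumpIso, this]
    norm_num [k.side_eq_zero]
    have := hl.le_eight (16 + (-2 - t))
    refine ⟨?_, ?_, ?_⟩ <;> linarith

/-- A tile that lies, near the apex of a nick, within that nick has the apex of a bump there. -/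
theorem exists_bump {d : ℝ} (hd : 3 ≤ d ∧ d ≤ 10) (k : Kind) (ψ : Plane ≃ᵢ Plane)
    (h0 : 0 ∈ ψ '' k.tile) (h : ∀ p ∈ bumpBox, p ∈ ψ '' k.tile → p ∈ wedge d) :
    ∃ e, ((k.bumpIso e).trans ψ) 0 = 0 := by
  obtain ⟨B, hB, hψ⟩ := h0
  by_contra! hne
  have hB' : ∀ e, k.bumpIso e 0 ≠ B := by
    rintro e rfl
    exact hne e hψ
  obtain ⟨u₀, u₁, v₀, v₁, hu, hv, huv, ε, hε, hT⟩ := k.hasWideAngle hB hB'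
  let χ := ((IsometryEquiv.addLeft B).trans ψ).toRealLinearIsometryEquivOfMapZero (by simp [hψ])
  have hχ : ∀ p, χ p = ψ (B + p) := fun p => rfl
  have key : ∀ w₀ w₁ : ℝ, (∀ t, 0 ≤ t → t ≤ ε → !₂[B 0 + t * w₀, B 1 + t * w₁] ∈ k.tile) →
      χ !₂[w₀, w₁] ∈ wedge d := by
    intro w₀ w₁ hw
    obtain ⟨ε', hε', h2⟩ := exists_smul_mem bumpBox_mem_nhds (χ !₂[w₀, w₁])
    have hpos : 0 < min ε ε' := lt_min hε hε'
    have h4 := h2 _ hpos.le (min_le_right _ _)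
    rw [← smul_mem_wedge_iff hpos]
    refine h _ h4 ⟨_, hw _ hpos.le (min_le_left _ _), ?_⟩
    rw [← map_smul, hχ]
    congr 1
    exact plane_ext (by simp) (by simp)
  have h1 := key _ _ fun t ht ht' => (hT t ht ht').1
  have h2 := key _ _ fun t ht ht' => (hT t ht ht').2
  have nz : ∀ w₀ w₁ : ℝ, w₀ ≠ 0 ∨ w₁ ≠ 0 → χ !₂[w₀, w₁] ≠ 0 := by
    intro w₀ w₁ hw h0
    rw [map_eq_zero_iff χ χ.injective] at h0
    have e0 := congrArg (fun p : Plane => p 0) h0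
    have e1 := congrArg (fun p : Plane => p 1) h0
    simp at e0 e1
    tauto
  -- The two wide directions would be mapped into an acute angle, contrary to the sign of their
  -- inner product.
  have := dot_pos_of_mem_wedge hd h1 h2 (nz _ _ hu) (nz _ _ hv)
  rw [dot_map] at this
  simp [dot] at this
  linarith

theorem image_preimage_bumpIso (k : Kind) (e : Edge) (ψ : Plane ≃ᵢ Plane) :
    ((k.bumpIso e).trans ψ) '' (k.bumpIso e ⁻¹' k.tile) = ψ '' k.tile := by
  change (ψ ∘ k.bumpIso e) '' _ = _
  rw [Set.image_comp, Set.image_preimage_eq _ (k.bumpIso e).surjective]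

/-- A nick of type `d` can be filled only by a bump of type `d`, in one way. -/
theorem exists_bumpIso_eq {d : ℝ} (hd : 3 ≤ d ∧ d ≤ 10) (k : Kind) (ψ : Plane ≃ᵢ Plane)
    (h : Fills d (ψ '' k.tile)) :
    ∃ e, k.bumpType e = d ∧ ψ = (k.bumpIso e).symm := by
  obtain ⟨e, he⟩ := k.exists_bump hd ψ h.zero_mem h.subset
  let χ := ((k.bumpIso e).trans ψ).toRealLinearIsometryEquivOfMapZero he
  have hχ : ∀ p, χ p = ψ (k.bumpIso e p) := fun p => rfl
  have hi : χ '' (k.bumpIso e ⁻¹' k.tile) = ψ '' k.tile := k.image_preimage_bumpIso e ψ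
  obtain ⟨h1, h2⟩ := Fills.eq_refl hd (k.bumpType_mem e) (k.isBump e) (k.foot_mem e) χ
    (by rwa [hi])
  refine ⟨e, h1, IsometryEquiv.ext fun p => ?_⟩
  have := h2 ((k.bumpIso e).symm p)
  rwa [hχ, IsometryEquiv.apply_symm_apply] at this

/-- The tile has a bump apex at the origin, and `middle` is a combination of the images of its legs
with positive coefficients. Hence two tiles inside one nick would overlap. -/
theorem middle_mem_interior {d : ℝ} (hd : 3 ≤ d ∧ d ≤ 10) (k : Kind) (ψ : Plane ≃ᵢ Plane)
    (h0 : 0 ∈ ψ '' k.tile) (h : ∀ p ∈ bumpBox, p ∈ ψ '' k.tile → p ∈ wedge d) :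
    ∃ ε > 0, ∀ t : ℝ, 0 < t → t ≤ ε → t • middle ∈ interior (ψ '' k.tile) := by
  obtain ⟨e, he⟩ := k.exists_bump hd ψ h0 h
  let χ := ((k.bumpIso e).trans ψ).toRealLinearIsometryEquivOfMapZero he
  have hi : χ '' (k.bumpIso e ⁻¹' k.tile) = ψ '' k.tile := k.image_preimage_bumpIso e ψ
  rw [← hi] at h
  have hT := k.isBump e
  have hd' := k.bumpType_mem e
  have hu := map_mem_wedge hT χ h (shortLeg_mem_wedge (by linarith [hd'.1]))
  have hv := map_mem_wedge hT χ h (longLeg_mem_wedge (by linarith [hd'.1]))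
  obtain ⟨a, b, ha, hb, hab⟩ := (isLegs_map χ (k.bumpType e)).middle_mem hd hd' hu hv
  have hab' : middle = χ (a • shortLeg + b • longLeg (k.bumpType e)) := by
    rw [hab, map_add, map_smul, map_smul]
  have hmem : a • shortLeg + b • longLeg (k.bumpType e) ∈ openWedge (k.bumpType e) := by
    have h1 : 0 < a * (k.bumpType e + 2) := mul_pos ha (by linarith [hd'.1])
    have h2 : 0 < b * (k.bumpType e + 2) := mul_pos hb (by linarith [hd'.1])
    simp only [openWedge, Set.mem_ofPred_eq, PiLp.add_apply, PiLp.smul_apply, smul_eq_mul,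
      shortLeg_zero, shortLeg_one, longLeg_zero, longLeg_one]
    constructor <;> linarith
  obtain ⟨ε, hε, h1⟩ := exists_smul_mem bumpBox_mem_nhds
    (a • shortLeg + b • longLeg (k.bumpType e))
  refine ⟨ε, hε, fun t ht ht' => ?_⟩
  have hsub : bumpBox ∩ openWedge (k.bumpType e) ⊆ interior (k.bumpIso e ⁻¹' k.tile) :=
    interior_maximal (fun p hp => (hT p hp.1).2 (openWedge_subset_wedge _ hp.2))
      (isOpen_bumpBox.inter (isOpen_openWedge _))
  rw [← hi]
  have himg := χ.toHomeomorph.image_interior (k.bumpIso e ⁻¹' k.tile)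
  change t • middle ∈ interior (χ.toHomeomorph '' _)
  rw [← himg, hab', ← map_smul]
  exact ⟨_, hsub ⟨h1 t ht.le ht', (smul_mem_openWedge_iff ht).2 hmem⟩, rfl⟩

end Kind

end

/-! ### The prototiles as topological discs -/

noncomputable section

theorem continuous_mk_plane {X : Type*} [TopologicalSpace X] {f g : X → ℝ} (hf : Continuous f)
    (hg : Continuous g) : Continuous fun x => (!₂[f x, g x] : Plane) := by
  refine (PiLp.continuous_toLp 2 _).comp (continuous_pi fun i => ?_)
  fin_cases i
  · exact hf
  · exact hg

theorem Profile.continuous {f : ℝ → ℝ} {d₁ d₂ : ℝ} {σ : ℤˣ} (h : Profile f d₁ d₂ σ) :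
    Continuous f :=
  (LipschitzWith.of_dist_le_mul (K := 8) fun x y => by
    simpa [Real.dist_eq] using h.lipschitz x y).continuous

/-- The homeomorphism `(x, y) ↦ (x + s y, y)`. -/
def shearHomeo (s : ℝ → ℝ) (hs : Continuous s) : Plane ≃ₜ Plane where
  toFun p := !₂[p 0 + s (p 1), p 1]
  invFun p := !₂[p 0 - s (p 1), p 1]
  left_inv p := plane_ext (by simp) (by simp)
  right_inv p := plane_ext (by simp) (by simp)
  continuous_toFun := continuous_mk_plane (by fun_prop) (by fun_prop)
  continuous_invFun := continuous_mk_plane (by fun_prop) (by fun_prop)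

/-- The homeomorphism that is the identity below the line `y = 54` and maps the line `y = 64` onto
the graph of `64 + u`. -/
def topHomeo (u : ℝ → ℝ) (hu : Continuous u) (h : ∀ x, -8 ≤ u x) : Plane ≃ₜ Plane where
  toFun p := !₂[p 0, p 1 + u (p 0) * max 0 (p 1 - 54) / 10]
  invFun p := !₂[p 0, p 1 - u (p 0) * max 0 (p 1 - 54) / (10 + u (p 0))]
  left_inv p := plane_ext (by simp) (by
    have h1 : 0 < 10 + u (p 0) := by linarith [h (p 0)]
    simp only [Matrix.cons_val_zero, Matrix.cons_val_one]
    rcases le_total (p 1) 54 with h2 | h2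
    · rw [max_eq_left (show p 1 - 54 ≤ 0 by linarith)]
      simp [h2]
    · rw [max_eq_right (show 0 ≤ p 1 - 54 by linarith), max_eq_right]
      · field_simp
        ring
      · have : p 1 + u (p 0) * (p 1 - 54) / 10 - 54 = (10 + u (p 0)) * (p 1 - 54) / 10 := by ring
        rw [this]
        exact div_nonneg (mul_nonneg h1.le (by linarith)) (by norm_num))
  right_inv p := plane_ext (by simp) (by
    have h1 : 0 < 10 + u (p 0) := by linarith [h (p 0)]
    simp only [Matrix.cons_val_zero, Matrix.cons_val_one]
    rcases le_total (p 1) 54 with h2 | h2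
    · rw [max_eq_left (show p 1 - 54 ≤ 0 by linarith)]
      simp [h2]
    · rw [max_eq_right (show 0 ≤ p 1 - 54 by linarith), max_eq_right]
      · field_simp
        ring
      · have : p 1 - u (p 0) * (p 1 - 54) / (10 + u (p 0)) - 54 =
            10 * (p 1 - 54) / (10 + u (p 0)) := by
          field_simp
          ring
        rw [this]
        exact div_nonneg (mul_nonneg (by norm_num) (by linarith)) h1.le)
  continuous_toFun := continuous_mk_plane (by fun_prop) (by fun_prop)
  continuous_invFun := continuous_mk_plane (by fun_prop)
    (Continuous.sub (by fun_prop) (Continuous.div (by fun_prop) (by fun_prop)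
      fun p => by linarith [h (p 0)]))

/-- The homeomorphism that is the identity above the line `y = 14` and maps the line `y = 0` onto
the graph of `b`. -/
def bottomHomeo (b : ℝ → ℝ) (hb : Continuous b) (h : ∀ x, b x ≤ 8) : Plane ≃ₜ Plane where
  toFun p := !₂[p 0, p 1 + b (p 0) * max 0 (14 - p 1) / 14]
  invFun p := !₂[p 0, p 1 - b (p 0) * max 0 (14 - p 1) / (14 - b (p 0))]
  left_inv p := plane_ext (by simp) (by
    have h1 : 0 < 14 - b (p 0) := by linarith [h (p 0)]
    simp only [Matrix.cons_val_zero, Matrix.cons_val_one]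
    rcases le_total 14 (p 1) with h2 | h2
    · rw [max_eq_left (show 14 - p 1 ≤ 0 by linarith)]
      simp [h2]
    · rw [max_eq_right (show 0 ≤ 14 - p 1 by linarith), max_eq_right]
      · field_simp
        ring
      · have : 14 - (p 1 + b (p 0) * (14 - p 1) / 14) = (14 - b (p 0)) * (14 - p 1) / 14 := by ring
        rw [this]
        exact div_nonneg (mul_nonneg h1.le (by linarith)) (by norm_num))
  right_inv p := plane_ext (by simp) (by
    have h1 : 0 < 14 - b (p 0) := by linarith [h (p 0)]
    simp only [Matrix.cons_val_zero, Matrix.cons_val_one]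
    rcases le_total 14 (p 1) with h2 | h2
    · rw [max_eq_left (show 14 - p 1 ≤ 0 by linarith)]
      simp [h2]
    · rw [max_eq_right (show 0 ≤ 14 - p 1 by linarith), max_eq_right]
      · field_simp
        ring
      · have : 14 - (p 1 - b (p 0) * (14 - p 1) / (14 - b (p 0))) =
            14 * (14 - p 1) / (14 - b (p 0)) := by
          field_simp
          ring
        rw [this]
        exact div_nonneg (mul_nonneg (by norm_num) (by linarith)) h1.le)
  continuous_toFun := continuous_mk_plane (by fun_prop) (by fun_prop)
  continuous_invFun := continuous_mk_plane (by fun_prop)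
    (Continuous.sub (by fun_prop) (Continuous.div (by fun_prop) (by fun_prop)
      fun p => by linarith [h (p 0)]))

/-- The square `[0, 64]²`. -/
def bigSquare : Set Plane := {p | 0 ≤ p 0 ∧ p 0 ≤ 64 ∧ 0 ≤ p 1 ∧ p 1 ≤ 64}

theorem isClosed_bigSquare : IsClosed bigSquare :=
  (isClosed_le (by fun_prop) (by fun_prop)).and <|
    (isClosed_le (by fun_prop) (by fun_prop)).and <|
    (isClosed_le (by fun_prop) (by fun_prop)).and (isClosed_le (by fun_prop) (by fun_prop))

theorem convex_bigSquare : Convex ℝ bigSquare := by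
  rintro p ⟨h1, h2, h3, h4⟩ q ⟨k1, k2, k3, k4⟩ a b ha hb hab
  simp only [bigSquare, Set.mem_ofPred_eq, PiLp.add_apply, PiLp.smul_apply, smul_eq_mul]
  refine ⟨?_, ?_, ?_, ?_⟩
  · positivity
  · nlinarith
  · positivity
  · nlinarith

theorem interior_bigSquare_nonempty : (interior bigSquare).Nonempty := by
  refine ⟨!₂[32, 32], mem_interior.2 ⟨{p | 0 < p 0 ∧ p 0 < 64 ∧ 0 < p 1 ∧ p 1 < 64},
    fun p hp => ⟨hp.1.le, hp.2.1.le, hp.2.2.1.le, hp.2.2.2.le⟩, ?_, ?_⟩⟩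
  · exact (isOpen_lt (by fun_prop) (by fun_prop)).and <|
      (isOpen_lt (by fun_prop) (by fun_prop)).and <|
      (isOpen_lt (by fun_prop) (by fun_prop)).and (isOpen_lt (by fun_prop) (by fun_prop))
  · norm_num

theorem isBounded_bigSquare : Bornology.IsBounded bigSquare := by
  refine (Metric.isBounded_closedBall (x := (0 : Plane)) (r := 128)).subset ?_
  rintro p ⟨h1, h2, h3, h4⟩
  rw [Metric.mem_closedBall, plane_dist_eq]
  refine Real.sqrt_le_iff.2 ⟨by norm_num, ?_⟩
  simp only [PiLp.zero_apply, sub_zero]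
  nlinarith

theorem IsClosedDisc.image {T : Set Plane} (h : IsClosedDisc T) (φ : Plane ≃ₜ Plane) :
    IsClosedDisc (φ '' T) :=
  ⟨(φ.image T).symm.trans h.some⟩

theorem isClosedDisc_bigSquare : IsClosedDisc bigSquare := by
  obtain ⟨h, -, h2, -⟩ := exists_homeomorph_image_interior_closure_frontier_eq_unitBall
    convex_bigSquare interior_bigSquare_nonempty isBounded_bigSquare
  rw [isClosed_bigSquare.closure_eq] at h2
  exact ⟨(h.image bigSquare).trans (Homeomorph.setCongr h2)⟩

theorem closure_interior_bigSquare : closure (interior bigSquare) = bigSquare := by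
  rw [convex_bigSquare.closure_interior_eq_closure_of_nonempty_interior
    interior_bigSquare_nonempty, isClosed_bigSquare.closure_eq]

namespace Kind

theorem exists_homeo (k : Kind) : ∃ H : Plane ≃ₜ Plane, H '' bigSquare = k.tile := by
  have hs := k.side_profile
  have hl := k.low_profile
  have hu := k.up_profile
  -- The vertical deformations act only above 54 and below 14, preserving both zones. The lateral
  -- curve vanishes there, so the three maps do not interfere.
  let H := ((topHomeo k.up hu.continuous hu.neg_eight_le).trans
    (bottomHomeo k.low hl.continuous hl.le_eight)).trans (shearHomeo k.side hs.continuous)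
  refine ⟨H, ?_⟩
  have key : ∀ p, H p ∈ k.tile ↔ p ∈ bigSquare := by
    intro p
    have l1 := hl.le_eight (p 0)
    have u1 := hu.neg_eight_le (p 0)
    have hH : H p = !₂[p 0 + k.side (p 1 + k.up (p 0) * max 0 (p 1 - 54) / 10 + k.low (p 0) *
          max 0 (14 - (p 1 + k.up (p 0) * max 0 (p 1 - 54) / 10)) / 14),
        p 1 + k.up (p 0) * max 0 (p 1 - 54) / 10 + k.low (p 0) *
          max 0 (14 - (p 1 + k.up (p 0) * max 0 (p 1 - 54) / 10)) / 14] := rfl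
    rw [hH, tile, mem_block_mk, bigSquare, Set.mem_ofPred_eq]
    rcases le_total (p 1) 54 with h1 | h1
    · rw [max_eq_left (show p 1 - 54 ≤ 0 by linarith), mul_zero, zero_div, add_zero]
      rcases le_total (p 1) 14 with h2 | h2
      · rw [max_eq_right (show 0 ≤ 14 - p 1 by linarith)]
        have e : 14 - (p 1 + k.low (p 0) * (14 - p 1) / 14) =
          (14 - k.low (p 0)) / 14 * (14 - p 1) := by ring
        have e' : p 1 + k.low (p 0) * (14 - p 1) / 14 - k.low (p 0) =
          (14 - k.low (p 0)) / 14 * p 1 := by ring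
        have e1 : 0 < (14 - k.low (p 0)) / 14 := by linarith
        have e2 : 0 ≤ (14 - k.low (p 0)) / 14 * (14 - p 1) := mul_nonneg e1.le (by linarith)
        have e3 : 0 ≤ (14 - k.low (p 0)) / 14 * p 1 ↔ 0 ≤ p 1 := mul_nonneg_iff_of_pos_left e1
        rw [hs.eq_zero_left _ (by linarith), add_zero, ← sub_nonneg (b := k.low (p 0)), e', e3]
        constructor
        · rintro ⟨a1, a2, a3, a4⟩
          refine ⟨?_, ?_, ?_, ?_⟩ <;> linarith
        · rintro ⟨a1, a2, a3, a4⟩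
          refine ⟨?_, ?_, ?_, ?_⟩ <;> linarith
      · rw [max_eq_left (show 14 - p 1 ≤ 0 by linarith), mul_zero, zero_div, add_zero]
        have l2 := hl.le_eight (p 0 + k.side (p 1))
        have u2 := hu.neg_eight_le (p 0 + k.side (p 1))
        constructor
        · rintro ⟨a1, a2, a3, a4⟩
          refine ⟨?_, ?_, ?_, ?_⟩ <;> linarith
        · rintro ⟨a1, a2, a3, a4⟩
          refine ⟨?_, ?_, ?_, ?_⟩ <;> linarith
    · rw [max_eq_right (show 0 ≤ p 1 - 54 by linarith)]
      have e : p 1 + k.up (p 0) * (p 1 - 54) / 10 - 54 =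
          (10 + k.up (p 0)) / 10 * (p 1 - 54) := by ring
      have e' : 64 + k.up (p 0) - (p 1 + k.up (p 0) * (p 1 - 54) / 10) =
        (10 + k.up (p 0)) / 10 * (64 - p 1) := by ring
      have e1 : 0 < (10 + k.up (p 0)) / 10 := by linarith
      have e2 : 0 ≤ (10 + k.up (p 0)) / 10 * (p 1 - 54) := mul_nonneg e1.le (by linarith)
      have e3 : 0 ≤ (10 + k.up (p 0)) / 10 * (64 - p 1) ↔ 0 ≤ 64 - p 1 :=
        mul_nonneg_iff_of_pos_left e1
      rw [max_eq_left (show 14 - (p 1 + k.up (p 0) * (p 1 - 54) / 10) ≤ 0 by linarith), mul_zero,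
        zero_div, add_zero, k.side_eq_zero (by linarith), add_zero,
        ← sub_nonneg (a := 64 + k.up (p 0)), e', e3]
      constructor
      · rintro ⟨a1, a2, a3, a4⟩
        refine ⟨?_, ?_, ?_, ?_⟩ <;> linarith
      · rintro ⟨a1, a2, a3, a4⟩
        refine ⟨?_, ?_, ?_, ?_⟩ <;> linarith
  ext q
  constructor
  · rintro ⟨p, hp, rfl⟩
    exact (key p).2 hp
  · intro hq
    refine ⟨H.symm q, (key _).1 (by simpa using hq), by simp⟩

theorem isClosedDisc (k : Kind) : IsClosedDisc k.tile := by
  obtain ⟨H, hH⟩ := k.exists_homeo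
  rw [← hH]
  exact isClosedDisc_bigSquare.image H

/-- The homeomorphism with the square extends to the whole plane, so it carries over that the square
is the closure of its interior. -/
theorem closure_interior (k : Kind) (φ : Plane ≃ᵢ Plane) :
    closure (interior (φ '' k.tile)) = φ '' k.tile := by
  obtain ⟨H, hH⟩ := k.exists_homeo
  have : φ '' k.tile = (H.trans φ.toHomeomorph) '' bigSquare := by
    rw [← hH, ← Set.image_comp]
    rfl
  rw [this, ← Homeomorph.image_interior, ← Homeomorph.image_closure, closure_interior_bigSquare]

theorem interior_nonempty (k : Kind) (φ : Plane ≃ᵢ Plane) : (interior (φ '' k.tile)).Nonempty := by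
  rw [← closure_nonempty_iff, k.closure_interior φ, Set.image_nonempty]
  obtain ⟨H, hH⟩ := k.exists_homeo
  rw [← hH, Set.image_nonempty]
  exact interior_bigSquare_nonempty.mono interior_subset

/-- The centre of the square. -/
def centre : Plane := !₂[32, 32]

@[simp] theorem centre_zero : centre 0 = 32 := by simp [centre]
@[simp] theorem centre_one : centre 1 = 32 := by simp [centre]

theorem tile_subset_ball (k : Kind) : k.tile ⊆ Metric.closedBall centre 60 := by
  rintro p ⟨h1, h2, h3, h4⟩
  rw [Metric.mem_closedBall, plane_dist_eq]
  refine Real.sqrt_le_iff.2 ⟨by norm_num, ?_⟩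
  rw [centre_zero, centre_one]
  have := k.side_profile.le_eight (p 1)
  have := k.side_profile.neg_eight_le (p 1)
  have := k.low_profile.neg_eight_le (p 0)
  have := k.up_profile.le_eight (p 0)
  nlinarith

theorem ball_subset_tile (k : Kind) : Metric.ball centre 20 ⊆ k.tile := by
  intro p hp
  rw [Metric.mem_ball, plane_dist_eq, Real.sqrt_lt' (by norm_num), centre_zero, centre_one] at hp
  have h1 := abs_lt.1 (abs_lt_of_sq_lt_sq (a := p 0 - 32) (b := 20)
    (by nlinarith [sq_nonneg (p 1 - 32)]) (by norm_num))
  have h2 := abs_lt.1 (abs_lt_of_sq_lt_sq (a := p 1 - 32) (b := 20)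
    (by nlinarith [sq_nonneg (p 0 - 32)]) (by norm_num))
  have := k.side_profile.le_eight (p 1)
  have := k.side_profile.neg_eight_le (p 1)
  have := k.low_profile.le_eight (p 0)
  have := k.up_profile.neg_eight_le (p 0)
  refine ⟨?_, ?_, ?_, ?_⟩ <;> linarith [h1.1, h1.2, h2.1, h2.2]

end Kind

end

/-! ### Every nick has a unique neighbour -/

noncomputable section

theorem rowProtoset_eq_range : rowProtoset = Set.range Kind.tile := by
  ext T
  simp only [rowProtoset, Set.mem_insert_iff, Set.mem_singleton_iff, Set.mem_range]
  constructor
  · rintro (rfl | rfl | rfl)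
    exacts [⟨.purple, rfl⟩, ⟨.green, rfl⟩, ⟨.red, rfl⟩]
  · rintro ⟨k, rfl⟩
    cases k
    exacts [Or.inl rfl, Or.inr (Or.inl rfl), Or.inr (Or.inr rfl)]

theorem IsTilingBy.exists_kind {𝒯 : Set (Set Plane)} (h : IsTilingBy rowProtoset 𝒯)
    {T : Set Plane} (hT : T ∈ 𝒯) : ∃ (k : Kind) (φ : Plane ≃ᵢ Plane), φ '' k.tile = T := by
  obtain ⟨P, hP, φ, hφ⟩ := h.congruent T hT
  rw [rowProtoset_eq_range] at hP
  obtain ⟨k, rfl⟩ := hP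
  exact ⟨k, φ, hφ⟩

theorem IsTilingBy.closure_interior {𝒯 : Set (Set Plane)} (h : IsTilingBy rowProtoset 𝒯)
    {T : Set Plane} (hT : T ∈ 𝒯) : closure (interior T) = T := by
  obtain ⟨k, φ, rfl⟩ := h.exists_kind hT
  exact k.closure_interior φ

theorem IsTilingBy.isClosed {𝒯 : Set (Set Plane)} (h : IsTilingBy rowProtoset 𝒯)
    {T : Set Plane} (hT : T ∈ 𝒯) : IsClosed T := by
  rw [← h.closure_interior hT]
  exact isClosed_closure

theorem IsTilingBy.disjoint_interior {𝒯 : Set (Set Plane)} (h : IsTilingBy rowProtoset 𝒯)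
    {S T : Set Plane} (hS : S ∈ 𝒯) (hT : T ∈ 𝒯) (hne : S ≠ T) : Disjoint (interior S) T := by
  have h1 : Disjoint (interior S) (interior T) :=
    Set.disjoint_iff_inter_eq_empty.2 (h.isTiling.interiors S hS T hT hne)
  have h2 := h1.closure_right isOpen_interior
  rwa [h.closure_interior hT] at h2

open MeasureTheory in
/-- Only finitely many tiles are near the origin. -/
theorem IsTilingBy.finite_near_zero {𝒯 : Set (Set Plane)} (h : IsTilingBy rowProtoset 𝒯) :
    {T | T ∈ 𝒯 ∧ (T ∩ Metric.ball 0 1).Nonempty}.Finite := by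
  set F := {T | T ∈ 𝒯 ∧ (T ∩ Metric.ball 0 1).Nonempty} with hF
  -- A tile contains a ball of radius 20 and lies within 60 of its centre. If it meets the unit
  -- ball, it lies within 60 + 60 + 1 of the origin, and only finitely many disjoint interiors of
  -- such volume fit there.
  have key : ∀ T ∈ F, volume (Metric.ball (0 : Plane) 20) ≤ volume (interior T) ∧
      interior T ⊆ Metric.closedBall 0 121 := by
    rintro T ⟨hT, p, hpT, hp⟩
    obtain ⟨k, φ, rfl⟩ := h.exists_kind hT
    constructor
    · have : Metric.ball (φ Kind.centre) 20 ⊆ φ '' k.tile := by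
        rw [← φ.image_ball]
        exact Set.image_mono k.ball_subset_tile
      rw [← Measure.addHaar_ball_center volume (φ Kind.centre)]
      exact measure_mono (interior_maximal this Metric.isOpen_ball)
    · refine interior_subset.trans ?_
      have hsub : φ '' k.tile ⊆ Metric.closedBall (φ Kind.centre) 60 := by
        rw [← φ.image_closedBall]
        exact Set.image_mono k.tile_subset_ball
      intro q hq
      have h1 := Metric.mem_closedBall.1 (hsub hq)
      have h2 := Metric.mem_closedBall'.1 (hsub hpT)
      have h3 := Metric.mem_ball.1 hp
      rw [Metric.mem_closedBall]
      linarith [dist_triangle4 q (φ Kind.centre) p 0]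
  have hfin := Measure.finite_const_le_meas_of_disjoint_iUnion (volume : Measure Plane)
    (ε := volume (Metric.ball (0 : Plane) 20)) (Metric.measure_ball_pos _ _ (by norm_num))
    (As := fun T : F => interior T.1) (fun T => isOpen_interior.measurableSet)
    (fun S T hne => Set.disjoint_iff_inter_eq_empty.2
      (h.isTiling.interiors S.1 S.2.1 T.1 T.2.1 fun e => hne (Subtype.ext e)))
    (ne_top_of_le_ne_top (measure_closedBall_lt_top (x := (0 : Plane)) (r := 121)).ne
      (measure_mono (Set.iUnion_subset fun T => (key T.1 T.2).2)))
  have huniv : {T : F | volume (Metric.ball (0 : Plane) 20) ≤ volume (interior T.1)} = Set.univ :=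
    Set.eq_univ_of_forall fun T => (key T.1 T.2).1
  rw [huniv] at hfin
  exact Set.finite_coe_iff.1 (Set.finite_univ_iff.1 hfin)

/-- The finitely many closed tiles that come near the origin but miss it have a closed union, hence
a positive distance from it. -/
theorem IsTilingBy.exists_radius {𝒯 : Set (Set Plane)} (h : IsTilingBy rowProtoset 𝒯) :
    ∃ r > 0, ∀ T ∈ 𝒯, (T ∩ Metric.ball 0 r).Nonempty → 0 ∈ T := by
  have hfin := h.finite_near_zero.subset
    (t := {T | T ∈ 𝒯 ∧ (T ∩ Metric.ball 0 1).Nonempty ∧ 0 ∉ T}) fun T hT => ⟨hT.1, hT.2.1⟩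
  have hclosed := hfin.isClosed_biUnion (f := id) fun T hT => h.isClosed hT.1
  have h0 : (0 : Plane) ∈ (⋃ T ∈ {T | T ∈ 𝒯 ∧ (T ∩ Metric.ball 0 1).Nonempty ∧ 0 ∉ T}, id T)ᶜ := by
    simp only [Set.mem_compl_iff, Set.mem_iUnion, not_exists]
    intro T hT
    exact hT.2.2
  obtain ⟨ε, hε, hε'⟩ := Metric.isOpen_iff.1 hclosed.isOpen_compl 0 h0
  refine ⟨min ε 1, lt_min hε one_pos, ?_⟩
  rintro T hT ⟨p, hpT, hp⟩
  by_contra hT0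
  refine hε' (Metric.ball_subset_ball (min_le_left _ _) hp) ?_
  exact Set.mem_biUnion (x := T)
    ⟨hT, ⟨p, hpT, Metric.ball_subset_ball (min_le_right _ _) hp⟩, hT0⟩ hpT

theorem middle_mem_openWedge {d : ℝ} (hd : 3 ≤ d) : middle ∈ openWedge d := by
  simp only [openWedge, Set.mem_ofPred_eq, middle_zero, middle_one]
  constructor <;> linarith

theorem add_smul_middle_mem_openWedge {d : ℝ} (hd : 3 ≤ d) {p : Plane} (hp : p ∈ wedge d) {t : ℝ}
    (ht : 0 < t) : p + t • middle ∈ openWedge d := by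
  obtain ⟨h1, h2⟩ := hp
  obtain ⟨h3, h4⟩ := (smul_mem_openWedge_iff ht).2 (middle_mem_openWedge hd)
  simp only [openWedge, Set.mem_ofPred_eq, PiLp.add_apply]
  constructor <;> linarith

/-- Every nick is filled by a single tile. -/
theorem IsTilingBy.exists_fills {𝒯 : Set (Set Plane)} (h : IsTilingBy rowProtoset 𝒯)
    {T : Set Plane} (hT : T ∈ 𝒯) {d : ℝ} (hd : 3 ≤ d ∧ d ≤ 10) (hnick : IsNick d T) :
    ∃ T' ∈ 𝒯, Fills d T' := by
  obtain ⟨r, hr, hr'⟩ := h.exists_radius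
  -- Within the box, the complement of the closed angle belongs to the interior of `T`, which no
  -- other tile meets.
  have hsub : ∀ S ∈ 𝒯, S ≠ T → ∀ p ∈ bumpBox, p ∈ S → p ∈ wedge d := by
    intro S hS hne p hp hpS
    by_contra hpw
    have hint : bumpBox ∩ (wedge d)ᶜ ⊆ interior T :=
      interior_maximal (fun q hq => (hnick q hq.1).2 fun hq' =>
          hq.2 (openWedge_subset_wedge d hq'))
        (isOpen_bumpBox.inter (isClosed_wedge d).isOpen_compl)
    exact Set.disjoint_left.1 (h.disjoint_interior hT hS hne.symm) (hint ⟨hp, hpw⟩) hpS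
  have hcover : ∀ p ∈ bumpBox, p ∈ openWedge d → p ∈ Metric.ball 0 r →
      ∃ S ∈ 𝒯, S ≠ T ∧ 0 ∈ S ∧ p ∈ S := by
    intro p hp hpw hpr
    obtain ⟨S, hS, hpS⟩ := Set.mem_sUnion.1 (h.isTiling.covers ▸ Set.mem_univ p)
    refine ⟨S, hS, ?_, hr' S hS ⟨p, hpS, hpr⟩, hpS⟩
    rintro rfl
    exact (hnick p hp).1 hpS hpw
  have hnhds : bumpBox ∩ Metric.ball 0 r ∈ nhds (0 : Plane) :=
    Filter.inter_mem bumpBox_mem_nhds (Metric.ball_mem_nhds _ hr)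
  obtain ⟨ε, hε, hε'⟩ := exists_smul_mem hnhds middle
  have hεm := hε' ε hε.le le_rfl
  obtain ⟨T', hT', hne, h0, -⟩ := hcover (ε • middle) hεm.1
    ((smul_mem_openWedge_iff hε).2 (middle_mem_openWedge hd.1)) hεm.2
  have hint : ∀ S ∈ 𝒯, S ≠ T → 0 ∈ S →
      ∃ ε > 0, ∀ t : ℝ, 0 < t → t ≤ ε → t • middle ∈ interior S := by
    intro S hS hSne hS0
    obtain ⟨k, ψ, rfl⟩ := h.exists_kind hS
    exact k.middle_mem_interior hd ψ hS0 (hsub _ hS hSne)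
  -- Both tiles contain a short segment along `middle` in their interiors.
  have huniq : ∀ S ∈ 𝒯, S ≠ T → 0 ∈ S → S = T' := by
    intro S hS hSne hS0
    by_contra hST
    obtain ⟨ε₁, hε₁, h1⟩ := hint S hS hSne hS0
    obtain ⟨ε₂, hε₂, h2⟩ := hint T' hT' hne h0
    have hpos := lt_min hε₁ hε₂
    exact Set.disjoint_left.1 (h.disjoint_interior hS hT' hST)
      (h1 _ hpos (min_le_left _ _)) (interior_subset (h2 _ hpos (min_le_right _ _)))
  refine ⟨T', hT', hsub T' hT' hne, ?_⟩
  obtain ⟨δ, hδ, hδ'⟩ := Metric.mem_nhds_iff.1 hnhds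
  refine ⟨δ, hδ, fun p hp hpδ => ?_⟩
  -- Only the open angle must be covered by tiles other than `T`. Points on its sides are limits
  -- along `middle` of points in it, and `T'` is closed.
  have hcont : Continuous fun t : ℝ => p + t • middle := by fun_prop
  have htend : Filter.Tendsto (fun t : ℝ => p + t • middle) (nhdsWithin 0 (Set.Ioi 0))
      (nhds p) := by
    have := (hcont.tendsto 0).mono_left (nhdsWithin_le_nhds (s := Set.Ioi 0))
    simpa using this
  refine (h.isClosed hT').mem_of_tendsto htend ?_
  filter_upwards [htend.eventually (Metric.isOpen_ball.mem_nhds hpδ), self_mem_nhdsWithin]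
    with t ht ht0
  obtain ⟨S, hS, hSne, hS0, hpS⟩ := hcover _ (hδ' ht).1
    (add_smul_middle_mem_openWedge hd.1 hp ht0) (hδ' ht).2
  rwa [← huniq S hS hSne hS0]

theorem CongruentFigures.trans_iso {P T : Set Plane} (h : CongruentFigures P T)
    (φ : Plane ≃ᵢ Plane) : CongruentFigures P (φ '' T) := by
  obtain ⟨ψ, rfl⟩ := h
  exact ⟨ψ.trans φ, Set.image_comp φ ψ P⟩

theorem IsTilingBy.image {𝓟 𝒯 : Set (Set Plane)} (h : IsTilingBy 𝓟 𝒯) (φ : Plane ≃ᵢ Plane) :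
    IsTilingBy 𝓟 ((fun T : Set Plane => φ '' T) '' 𝒯) := by
  refine ⟨⟨h.isTiling.countable.image _, ?_, ?_, ?_⟩, ?_⟩
  · rintro _ ⟨T, hT, rfl⟩
    exact (h.isTiling.isClosedDisc T hT).image φ.toHomeomorph
  · rw [Set.sUnion_image, ← Set.image_iUnion₂, ← Set.sUnion_eq_biUnion, h.isTiling.covers,
      Set.image_univ, φ.surjective.range_eq]
  · rintro _ ⟨S, hS, rfl⟩ _ ⟨T, hT, rfl⟩ hne
    have h1 := h.isTiling.interiors S hS T hT fun e => hne (e ▸ rfl)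
    have e : ∀ S : Set Plane, interior (φ '' S) = φ '' interior S :=
      fun S => (φ.toHomeomorph.image_interior S).symm
    rw [e, e, ← Set.image_inter φ.injective, h1, Set.image_empty]
  · rintro _ ⟨T, hT, rfl⟩
    obtain ⟨P, hP, hPT⟩ := h.congruent T hT
    exact ⟨P, hP, hPT.trans_iso φ⟩

/-- The neighbour of a tile at a given side. -/
theorem IsTilingBy.exists_neighbour {𝒯 : Set (Set Plane)} (h : IsTilingBy rowProtoset 𝒯)
    (k : Kind) (φ : Plane ≃ᵢ Plane) (hk : φ '' k.tile ∈ 𝒯) (e : Edge) :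
    ∃ (k' : Kind) (e' : Edge), k'.bumpType e' = k.nickType e ∧
      (((k'.bumpIso e').symm.trans (k.nickIso e)).trans φ) '' k'.tile ∈ 𝒯 := by
  -- Pulling the tiling back by `ρ` puts the nick into standard position.
  set ρ := (k.nickIso e).trans φ with hρ
  have h' := h.image ρ.symm
  have hmem : k.nickIso e ⁻¹' k.tile ∈ (fun T : Set Plane => ρ.symm '' T) '' 𝒯 := by
    refine ⟨_, hk, ?_⟩
    ext p
    simp only [Set.mem_image, Set.mem_preimage, exists_exists_and_eq_and]
    constructor
    · rintro ⟨q, hq, rfl⟩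
      simpa [hρ] using hq
    · intro hp
      exact ⟨_, hp, by simp [hρ]⟩
  obtain ⟨_, ⟨T', hT', rfl⟩, hfills⟩ := h'.exists_fills hmem (k.nickType_mem e) (k.isNick e)
  obtain ⟨k', ψ, rfl⟩ := h.exists_kind hT'
  have hcomp : ρ.symm '' (ψ '' k'.tile) = (ψ.trans ρ.symm) '' k'.tile :=
    (Set.image_comp ρ.symm ψ _).symm
  simp only at hfills
  rw [hcomp] at hfills
  obtain ⟨e', he', hψ⟩ := k'.exists_bumpIso_eq (k.nickType_mem e) _ hfills
  refine ⟨k', e', he', ?_⟩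
  have : ((k'.bumpIso e').symm.trans (k.nickIso e)).trans φ = ψ := by
    rw [← hψ]
    ext1 p
    simp [hρ]
  rwa [this]

/-- An isometry that maps a prototile onto another one maps each bump onto a bump. -/
theorem Kind.exists_bump_of_congruent (k k' : Kind) (φ : Plane ≃ᵢ Plane)
    (h : φ '' k.tile = k'.tile) (e : Edge) :
    ∃ e', k'.bumpType e' = k.bumpType e ∧ (k.bumpIso e).trans φ = k'.bumpIso e' := by
  -- In standard position for the bump at `e`, the tile fills that bump's own angle, so the
  -- uniqueness of the filling applies to it as an image of `k'.tile`.
  set ψ := ((k.bumpIso e).trans φ).symm with hψ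
  have hfill : Fills (k.bumpType e) (ψ '' k'.tile) := by
    have : ψ '' k'.tile = k.bumpIso e ⁻¹' k.tile := by
      rw [← h]
      ext p
      simp only [Set.mem_image, Set.mem_preimage, exists_exists_and_eq_and]
      constructor
      · rintro ⟨q, hq, rfl⟩
        simpa [hψ] using hq
      · intro hp
        exact ⟨_, hp, by simp [hψ]⟩
    rw [this]
    exact (k.isBump e).fills
  obtain ⟨e', h1, h2⟩ := k'.exists_bumpIso_eq (k.bumpType_mem e) ψ hfill
  refine ⟨e', h1, ?_⟩
  rw [hψ] at h2
  ext1 p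
  have := congrArg IsometryEquiv.symm h2
  rw [IsometryEquiv.symm_symm, IsometryEquiv.symm_symm] at this
  rw [this]

end

/-! ### Matching rules between neighbouring tiles -/

noncomputable section

@[simp] theorem signedIso_symm_apply_zero (σ τ : ℤˣ) (a b : ℝ) (p : Plane) :
    (signedIso σ τ a b).symm p 0 = sgn σ * (p 0 - a) := by
  change (!₂[sgn σ * (p 0 - a), sgn τ * (p 1 - b)] : Plane) 0 = _
  simp

@[simp] theorem signedIso_symm_apply_one (σ τ : ℤˣ) (a b : ℝ) (p : Plane) :
    (signedIso σ τ a b).symm p 1 = sgn τ * (p 1 - b) := by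
  change (!₂[sgn σ * (p 0 - a), sgn τ * (p 1 - b)] : Plane) 1 = _
  simp

@[simp] theorem swapIso_symm : swapIso.symm = swapIso := rfl

theorem isometryEquiv_symm_trans (φ ψ : Plane ≃ᵢ Plane) :
    (φ.trans ψ).symm = ψ.symm.trans φ.symm := rfl

theorem isometryEquiv_trans_assoc (φ ψ χ : Plane ≃ᵢ Plane) :
    (φ.trans ψ).trans χ = φ.trans (ψ.trans χ) := rfl

/-- The translation by `(64 i, 64 j)`. -/
def move (i j : ℤ) : Plane ≃ᵢ Plane := signedIso 1 1 (64 * i) (64 * j)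

/-- The half-turn about the centre of the square. -/
def halfTurn : Plane ≃ᵢ Plane := signedIso (-1) (-1) 64 64

theorem move_trans_move (i j i' j' : ℤ) :
    (move i j).trans (move i' j') = move (i + i') (j + j') := by
  ext1 p
  refine plane_ext ?_ ?_ <;> simp [move] <;> ring_nf

theorem move_trans_halfTurn (i j : ℤ) :
    (move i j).trans halfTurn = halfTurn.trans (move (-i) (-j)) := by
  ext1 p
  refine plane_ext ?_ ?_ <;> simp [move, halfTurn] <;> ring_nf

theorem move_zero : move 0 0 = IsometryEquiv.refl Plane := by
  ext1 p
  refine plane_ext ?_ ?_ <;> simp [move] <;> rfl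

theorem image_trans (φ ψ : Plane ≃ᵢ Plane) (T : Set Plane) :
    (φ.trans ψ) '' T = ψ '' (φ '' T) := Set.image_comp ψ φ T

theorem isometryEquiv_image_eq (φ : Plane ≃ᵢ Plane) (T : Set Plane) : φ '' T = φ.symm ⁻¹' T :=
  φ.toEquiv.image_eq_preimage_symm T

theorem shifted_eq_image (T : Set Plane) (i j : ℤ) : shifted T i j = move i j '' T := by
  rw [isometryEquiv_image_eq]
  ext p
  have : (move i j).symm p = !₂[p 0 - 64 * (i : ℝ), p 1 - 64 * (j : ℝ)] := by
    refine plane_ext ?_ ?_ <;> simp [move]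
  rw [Set.mem_preimage, this]
  rfl

theorem turned_eq_image (T : Set Plane) : turned T = halfTurn '' T := by
  rw [isometryEquiv_image_eq]
  ext p
  have : halfTurn.symm p = !₂[64 - p 0, 64 - p 1] := by
    refine plane_ext ?_ ?_ <;> simp [halfTurn]
  rw [Set.mem_preimage, this]
  rfl

theorem turned_block (s b u : ℝ → ℝ) :
    turned (block s b u) =
      block (fun y => -s (64 - y)) (fun x => -u (64 - x)) (fun x => -b (64 - x)) := by
  ext p
  simp only [turned, block, Set.mem_ofPred_eq, Matrix.cons_val_zero,
    Matrix.cons_val_one]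
  constructor <;> rintro ⟨h1, h2, h3, h4⟩ <;> refine ⟨?_, ?_, ?_, ?_⟩ <;> linarith

theorem turned_red : turned Kind.red.tile = Kind.red.tile := by
  change turned (block redSide selfProfile selfProfile) = block redSide selfProfile selfProfile
  rw [turned_block]
  simp only [redSide_turn, selfProfile_turn, neg_neg]

/-- Turned red neighbours may thus be recorded as unturned ones. -/
theorem image_halfTurn_trans_red (φ : Plane ≃ᵢ Plane) :
    (halfTurn.trans φ) '' Kind.red.tile = φ '' Kind.red.tile := by
  rw [image_trans, ← turned_eq_image, turned_red]

namespace Edge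

def opposite : Edge → Edge
  | left => right
  | right => left
  | lower => upper
  | upper => lower

/-- The translation that maps a square to its neighbour at a given side. -/
def step : Edge → Plane ≃ᵢ Plane
  | left => move (-1) 0
  | right => move 1 0
  | lower => move 0 (-1)
  | upper => move 0 1

end Edge

/-- A bump that fits into a nick does so in the way in which it does in a row tiling. -/
theorem Kind.bumpIso_symm_trans_nickIso {k k' : Kind} {e e' : Edge}
    (h : k'.bumpType e' = k.nickType e) :
    (e' = e.opposite ∧ (k'.bumpIso e').symm.trans (k.nickIso e) = e.step) ∨
      (e' = e ∧ (k'.bumpIso e').symm.trans (k.nickIso e) = halfTurn.trans e.step) := by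
  have iso_ext : ∀ {φ ψ : Plane ≃ᵢ Plane}, (∀ p, φ p 0 = ψ p 0 ∧ φ p 1 = ψ p 1) → φ = ψ :=
    fun h => IsometryEquiv.ext fun p => plane_ext (h p).1 (h p).2
  -- Lateral types are at most 7 and the others at least 8, which excludes quarter-turns. The
  -- half-turn arises only for the types 7 and 8, where bump and nick of one side agree.
  cases k <;> cases e <;> cases k' <;> cases e' <;>
    norm_num [bumpType, nickType, sideType₁, sideType₂, lowType₁, lowType₂, upType₁, upType₂] at h
  all_goals first
    | refine Or.inl ⟨rfl, iso_ext fun p => ?_⟩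
      simp only [bumpIso, nickIso, Edge.step, move, sideSign, lowSign, upSign,
        isometryEquiv_symm_trans, IsometryEquiv.trans_apply, signedIso_apply_zero,
        signedIso_apply_one, signedIso_symm_apply_zero, signedIso_symm_apply_one, swapIso_symm,
        swapIso_apply_zero, swapIso_apply_one, sgn_one, sgn_neg_one, Int.cast_one, Int.cast_zero,
        Int.cast_neg]
      constructor <;> ring1
    | refine Or.inr ⟨rfl, iso_ext fun p => ?_⟩
      simp only [bumpIso, nickIso, Edge.step, move, sideSign, lowSign, upSign, halfTurn,
        isometryEquiv_symm_trans, IsometryEquiv.trans_apply, signedIso_apply_zero,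
        signedIso_apply_one, signedIso_symm_apply_zero, signedIso_symm_apply_one, swapIso_symm,
        swapIso_apply_zero, swapIso_apply_one, sgn_one, sgn_neg_one, Int.cast_one, Int.cast_zero,
        Int.cast_neg]
      constructor <;> ring1

theorem IsTilingBy.exists_neighbour_step {𝒯 : Set (Set Plane)} (h : IsTilingBy rowProtoset 𝒯)
    (φ : Plane ≃ᵢ Plane) (k : Kind) (hk : φ '' k.tile ∈ 𝒯) (e : Edge) :
    ∃ k' : Kind,
      (k'.bumpType e.opposite = k.nickType e ∧ (e.step.trans φ) '' k'.tile ∈ 𝒯) ∨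
      (k'.bumpType e = k.nickType e ∧ ((halfTurn.trans e.step).trans φ) '' k'.tile ∈ 𝒯) := by
  obtain ⟨k', e', ht, hmem⟩ := h.exists_neighbour k φ hk e
  refine ⟨k', ?_⟩
  rcases Kind.bumpIso_symm_trans_nickIso ht with ⟨rfl, h'⟩ | ⟨rfl, h'⟩
  · exact Or.inl ⟨ht, h' ▸ hmem⟩
  · exact Or.inr ⟨ht, h' ▸ hmem⟩

section Neighbours

open Kind

variable {𝒯 : Set (Set Plane)} (φ : Plane ≃ᵢ Plane)

/-- The types 3, 5 and 7 of the left nicks each occur as bumps of one kind only. For red two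
positions fit, but they yield the same figure. -/
theorem IsTilingBy.left_neighbour (h : IsTilingBy rowProtoset 𝒯) (k : Kind)
    (hk : φ '' k.tile ∈ 𝒯) : ((move (-1) 0).trans φ) '' k.tile ∈ 𝒯 := by
  obtain ⟨k', ⟨ht, h'⟩ | ⟨ht, h'⟩⟩ := h.exists_neighbour_step φ k hk .left <;>
    cases k <;> cases k' <;>
    norm_num [bumpType, nickType, sideType₁, sideType₂, Edge.opposite] at ht
  · exact h'
  · exact h'
  · exact h'
  · exact image_halfTurn_trans_red _ ▸ h'

theorem IsTilingBy.right_neighbour (h : IsTilingBy rowProtoset 𝒯) (k : Kind)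
    (hk : φ '' k.tile ∈ 𝒯) : ((move 1 0).trans φ) '' k.tile ∈ 𝒯 := by
  obtain ⟨k', ⟨ht, h'⟩ | ⟨ht, h'⟩⟩ := h.exists_neighbour_step φ k hk .right <;>
    cases k <;> cases k' <;>
    norm_num [bumpType, nickType, sideType₁, sideType₂, Edge.opposite] at ht
  · exact h'
  · exact h'
  · exact h'
  · exact image_halfTurn_trans_red _ ▸ h'

/-- The upper nick has type 10, and the only bump of that type is on the lower side of purple. -/
theorem IsTilingBy.above_of_ne_red (h : IsTilingBy rowProtoset 𝒯) {k : Kind} (hred : k ≠ red)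
    (hk : φ '' k.tile ∈ 𝒯) : ((move 0 1).trans φ) '' purple.tile ∈ 𝒯 := by
  obtain ⟨k', ⟨ht, h'⟩ | ⟨ht, h'⟩⟩ := h.exists_neighbour_step φ k hk .upper <;>
    cases k <;> cases k' <;> first | exact absurd rfl hred |
    norm_num [bumpType, nickType, lowType₂, upType₁, upType₂, Edge.opposite] at ht
  · exact h'
  · exact h'

/-- Bumps of type 8 occur on both horizontal sides of red and on the lower side of green. The upper
bump of green has type 9, so a turned green tile does not fit here. -/
theorem IsTilingBy.above_red (h : IsTilingBy rowProtoset 𝒯) (hk : φ '' red.tile ∈ 𝒯) :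
    ((move 0 1).trans φ) '' red.tile ∈ 𝒯 ∨ ((move 0 1).trans φ) '' green.tile ∈ 𝒯 := by
  obtain ⟨k', ⟨ht, h'⟩ | ⟨ht, h'⟩⟩ := h.exists_neighbour_step φ red hk .upper <;> cases k' <;>
    norm_num [bumpType, nickType, lowType₂, upType₁, upType₂, Edge.opposite] at ht
  · exact Or.inr h'
  · exact Or.inl h'
  · exact Or.inl (image_halfTurn_trans_red _ ▸ h')

/-- Bumps of type 9 occur only on the upper sides of purple and green. -/
theorem IsTilingBy.below_purple (h : IsTilingBy rowProtoset 𝒯) (hk : φ '' purple.tile ∈ 𝒯) :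
    ((move 0 (-1)).trans φ) '' purple.tile ∈ 𝒯 ∨ ((move 0 (-1)).trans φ) '' green.tile ∈ 𝒯 := by
  obtain ⟨k', ⟨ht, h'⟩ | ⟨ht, h'⟩⟩ := h.exists_neighbour_step φ purple hk .lower <;> cases k' <;>
    norm_num [bumpType, nickType, lowType₁, lowType₂, upType₁, Edge.opposite] at ht
  · exact Or.inl h'
  · exact Or.inr h'

/-- The nick has type 8 again, but from below a green tile can present its bump of type 8 only when
turned. -/
theorem IsTilingBy.below_of_ne_purple (h : IsTilingBy rowProtoset 𝒯) {k : Kind}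
    (hpurple : k ≠ purple) (hk : φ '' k.tile ∈ 𝒯) :
    ((move 0 (-1)).trans φ) '' red.tile ∈ 𝒯 ∨
      ((halfTurn.trans (move 0 (-1))).trans φ) '' green.tile ∈ 𝒯 := by
  obtain ⟨k', ⟨ht, h'⟩ | ⟨ht, h'⟩⟩ := h.exists_neighbour_step φ k hk .lower <;>
    cases k <;> cases k' <;> first | exact absurd rfl hpurple |
    norm_num [bumpType, nickType, lowType₁, lowType₂, upType₁, Edge.opposite] at ht
  · exact Or.inl h'
  · exact Or.inl h'
  · exact Or.inr h'
  · exact Or.inl (image_halfTurn_trans_red _ ▸ h')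
  · exact Or.inr h'
  · exact Or.inl (image_halfTurn_trans_red _ ▸ h')

theorem IsTilingBy.row_mem (h : IsTilingBy rowProtoset 𝒯) (k : Kind)
    (hk : φ '' k.tile ∈ 𝒯) (i : ℤ) : ((move i 0).trans φ) '' k.tile ∈ 𝒯 := by
  induction i using Int.induction_on with
  | zero => rwa [move_zero]
  | succ i ih =>
    have := h.right_neighbour _ k ih
    rwa [← isometryEquiv_trans_assoc, move_trans_move, add_comm, zero_add] at this
  | pred i ih =>
    have := h.left_neighbour _ k ih
    rwa [← isometryEquiv_trans_assoc, move_trans_move, zero_add, neg_add_eq_sub] at this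

theorem IsTilingBy.purple_above (h : IsTilingBy rowProtoset 𝒯) {k : Kind} (hred : k ≠ red)
    (hk : φ '' k.tile ∈ 𝒯) (n : ℕ) : ((move 0 (n + 1)).trans φ) '' purple.tile ∈ 𝒯 := by
  induction n with
  | zero => simpa using h.above_of_ne_red φ hred hk
  | succ n ih =>
    have := h.above_of_ne_red _ (by simp) ih
    rw [← isometryEquiv_trans_assoc, move_trans_move] at this
    convert! this using 4
    push_cast
    ring_nf

end Neighbours

end

/-! ### The row patterns are tilings -/

noncomputable section

/-- The sides `s j` and the curves `c j` between the rows of a tiling by rows. -/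
structure RowCurves (s c : ℤ → ℝ → ℝ) : Prop where
  side_le : ∀ j y, s j y ≤ 8
  neg_le_side : ∀ j y, -8 ≤ s j y
  side_low : ∀ j y, y ≤ 10 → s j y = 0
  side_high : ∀ j y, 54 ≤ y → s j y = 0
  curve_le : ∀ j x, c j x ≤ 8
  neg_le_curve : ∀ j x, -8 ≤ c j x
  curve_zero : ∀ j, c j 0 = 0
  curve_end : ∀ j, c j 64 = 0

theorem mem_shifted_block {s b u : ℝ → ℝ} {i j : ℤ} {p : Plane} :
    p ∈ shifted (block s b u) i j ↔
      s (p 1 - 64 * j) ≤ p 0 - 64 * i ∧ p 0 - 64 * i ≤ 64 + s (p 1 - 64 * j) ∧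
        b (p 0 - 64 * i) ≤ p 1 - 64 * j ∧ p 1 - 64 * j ≤ 64 + u (p 0 - 64 * i) :=
  mem_block_mk

theorem sub_mul_floor_mem (x : ℝ) : 0 ≤ x - 64 * ⌊x / 64⌋ ∧ x - 64 * ⌊x / 64⌋ ≤ 64 := by
  have h1 := Int.floor_le (x / 64)
  have h2 := (Int.lt_floor_add_one (x / 64)).le
  constructor <;> linarith

theorem RowCurves.covers {s c : ℤ → ℝ → ℝ} (h : RowCurves s c) :
    ⋃₀ rowTiling (fun j => block (s j) (c j) (c (j + 1))) = Set.univ := by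
  refine Set.eq_univ_of_forall fun p => ?_
  suffices ∃ i j : ℤ, p ∈ shifted (block (s j) (c j) (c (j + 1))) i j by
    obtain ⟨i, j, hp⟩ := this
    exact ⟨_, ⟨i, j, rfl⟩, hp⟩
  obtain ⟨x1, x2⟩ := sub_mul_floor_mem (p 0)
  obtain ⟨y1, y2⟩ := sub_mul_floor_mem (p 1)
  set i₀ := ⌊p 0 / 64⌋
  set j₀ := ⌊p 1 / 64⌋
  -- The row is chosen by the curves over the square column of the point. The column is corrected
  -- afterwards, only at heights where the curves no longer matter.
  obtain ⟨j, hj1, hj2⟩ : ∃ j : ℤ, c j (p 0 - 64 * i₀) ≤ p 1 - 64 * j ∧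
      p 1 - 64 * j ≤ 64 + c (j + 1) (p 0 - 64 * i₀) := by
    rcases lt_or_ge (p 1 - 64 * j₀) (c j₀ (p 0 - 64 * i₀)) with h1 | h1
    · refine ⟨j₀ - 1, ?_, ?_⟩
      · have := h.curve_le (j₀ - 1) (p 0 - 64 * i₀)
        push_cast
        linarith
      · rw [sub_add_cancel]
        push_cast
        linarith
    · rcases lt_or_ge (64 + c (j₀ + 1) (p 0 - 64 * i₀)) (p 1 - 64 * j₀) with h2 | h2
      · refine ⟨j₀ + 1, ?_, ?_⟩
        · push_cast
          linarith
        · have := h.neg_le_curve (j₀ + 1 + 1) (p 0 - 64 * i₀)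
          push_cast
          linarith
      · exact ⟨j₀, h1, h2⟩
  simp only [mem_shifted_block]
  by_cases hy : 8 ≤ p 1 - 64 * j ∧ p 1 - 64 * j ≤ 56
  · obtain ⟨i, hi1, hi2⟩ : ∃ i : ℤ, s j (p 1 - 64 * j) ≤ p 0 - 64 * i ∧
        p 0 - 64 * i ≤ 64 + s j (p 1 - 64 * j) := by
      have a1 := h.side_le j (p 1 - 64 * j)
      have a2 := h.neg_le_side j (p 1 - 64 * j)
      rcases lt_or_ge (p 0 - 64 * i₀) (s j (p 1 - 64 * j)) with h1 | h1
      · refine ⟨i₀ - 1, ?_, ?_⟩ <;> push_cast <;> linarith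
      · rcases lt_or_ge (64 + s j (p 1 - 64 * j)) (p 0 - 64 * i₀) with h2 | h2
        · refine ⟨i₀ + 1, ?_, ?_⟩ <;> push_cast <;> linarith
        · exact ⟨i₀, h1, h2⟩
    have := h.curve_le j (p 0 - 64 * i)
    have := h.neg_le_curve (j + 1) (p 0 - 64 * i)
    exact ⟨i, j, hi1, hi2, by linarith [hy.1], by linarith [hy.2]⟩
  · have hs : s j (p 1 - 64 * j) = 0 := by
      rcases lt_or_ge (p 1 - 64 * j) 8 with h1 | h1
      · exact h.side_low _ _ (by linarith)
      · refine h.side_high _ _ ?_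
        by_contra! h2
        exact hy ⟨h1, by linarith⟩
    refine ⟨i₀, j, ?_, ?_, hj1, hj2⟩ <;> rw [hs] <;> linarith

/-- Within an open set one can move a little to the right and upwards. -/
theorem exists_add_mem {U : Set Plane} (hU : IsOpen U) {p : Plane} (hp : p ∈ U) (v : Plane) :
    ∃ t : ℝ, 0 < t ∧ p + t • v ∈ U := by
  have hcont : Continuous fun t : ℝ => p + t • v := by fun_prop
  have htend : Filter.Tendsto (fun t : ℝ => p + t • v) (nhdsWithin 0 (Set.Ioi 0))
      (nhds p) := by
    have := (hcont.tendsto 0).mono_left (nhdsWithin_le_nhds (s := Set.Ioi 0))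
    simpa using this
  obtain ⟨t, ht, ht0⟩ := ((htend.eventually (hU.mem_nhds hp)).and self_mem_nhdsWithin).exists
  exact ⟨t, ht0, ht⟩

theorem RowCurves.interior_inter_of_lt {s c : ℤ → ℝ → ℝ} (h : RowCurves s c) {i j i' j' : ℤ}
    (hlt : j < j' ∨ (j = j' ∧ i < i')) :
    interior (shifted (block (s j) (c j) (c (j + 1))) i j) ∩
      interior (shifted (block (s j') (c j') (c (j' + 1))) i' j') = ∅ := by
  rw [Set.eq_empty_iff_forall_notMem]
  rintro p ⟨hpS, hpT⟩
  obtain ⟨b1, b2, b3, b4⟩ := mem_shifted_block.1 (interior_subset hpT)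
  rcases hlt with hj | ⟨rfl, hi⟩
  · obtain ⟨t, ht, hpt⟩ := exists_add_mem isOpen_interior hpS !₂[0, 1]
    obtain ⟨a1, a2, a3, a4⟩ := mem_shifted_block.1 (interior_subset hpS)
    obtain ⟨-, -, -, a5⟩ := mem_shifted_block.1 (interior_subset hpt)
    simp at a5
    have c1 := h.curve_le (j + 1) (p 0 - 64 * i)
    have c2 := h.neg_le_curve j' (p 0 - 64 * i')
    rcases (Int.add_one_le_iff.2 hj).eq_or_lt with rfl | hj'
    · have c3 := h.neg_le_curve (j + 1) (p 0 - 64 * i)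
      push_cast at b1 b2 b3 b4
      rw [h.side_high _ _ (by linarith)] at a1 a2
      rw [h.side_low _ _ (by linarith)] at b1 b2
      -- Near the common curve the lateral sides are straight. Tiles of different columns then meet
      -- only on a vertical grid line, where the curve vanishes as seen from either column.
      have hcurve : c (j + 1) (p 0 - 64 * i) = c (j + 1) (p 0 - 64 * i') := by
        rcases lt_trichotomy i i' with hi | rfl | hi
        · have hi' : (i : ℝ) + 1 ≤ i' := by exact_mod_cast hi
          rw [show p 0 - 64 * (i : ℝ) = 64 by linarith, show p 0 - 64 * (i' : ℝ) = 0 by linarith,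
            h.curve_zero, h.curve_end]
        · rfl
        · have hi' : (i' : ℝ) + 1 ≤ i := by exact_mod_cast hi
          rw [show p 0 - 64 * (i : ℝ) = 0 by linarith, show p 0 - 64 * (i' : ℝ) = 64 by linarith,
            h.curve_zero, h.curve_end]
      linarith
    · have : (j : ℝ) + 2 ≤ j' := by exact_mod_cast (by omega : j + 2 ≤ j')
      linarith
  · obtain ⟨t, ht, hpt⟩ := exists_add_mem isOpen_interior hpS !₂[1, 0]
    obtain ⟨-, a5, -, -⟩ := mem_shifted_block.1 (interior_subset hpt)
    simp at a5
    have : (i : ℝ) + 1 ≤ i' := by exact_mod_cast hi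
    linarith

theorem RowCurves.interiors {s c : ℤ → ℝ → ℝ} (h : RowCurves s c) :
    ∀ S ∈ rowTiling (fun j => block (s j) (c j) (c (j + 1))),
      ∀ T ∈ rowTiling (fun j => block (s j) (c j) (c (j + 1))), S ≠ T →
        interior S ∩ interior T = ∅ := by
  rintro _ ⟨i, j, rfl⟩ _ ⟨i', j', rfl⟩ hne
  rcases lt_trichotomy j j' with hj | rfl | hj
  · exact h.interior_inter_of_lt (Or.inl hj)
  · rcases lt_trichotomy i i' with hi | rfl | hi
    · exact h.interior_inter_of_lt (Or.inr ⟨rfl, hi⟩)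
    · exact absurd rfl hne
    · rw [Set.inter_comm]
      exact h.interior_inter_of_lt (Or.inr ⟨rfl, hi⟩)
  · rw [Set.inter_comm]
    exact h.interior_inter_of_lt (Or.inl hj)

theorem rowTiling_countable (r : ℤ → Set Plane) : (rowTiling r).Countable := by
  have : rowTiling r = Set.range fun q : ℤ × ℤ => shifted (r q.2) q.1 q.2 := by
    ext T
    simp only [rowTiling, Set.mem_ofPred_eq, Set.mem_range, Prod.exists]
    exact exists₂_congr fun i j => eq_comm
  rw [this]
  exact Set.countable_range _

namespace RowPattern

/-- The prototile of the `j`-th row. -/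
def kind : RowPattern → ℤ → Kind
  | .allPurple, _ => .purple
  | .allRed, _ => .red
  | .greenOverRed, j => if 0 < j then .purple else if j = 0 then .green else .red
  | .redBetweenGreen n, j =>
      if 0 < j then .purple
      else if j = 0 then .green
      else if -(n : ℤ) ≤ j then .red
      else if j = -(n : ℤ) - 1 then .green
      else .purple

/-- The `j`-th row is turned upside down. -/
def IsTurned : RowPattern → ℤ → Prop
  | .redBetweenGreen n, j => j < -(n : ℤ)
  | _, _ => False

open Classical in
/-- The isometry by which the prototile is turned in the `j`-th row. -/
def flip (c : RowPattern) (j : ℤ) : Plane ≃ᵢ Plane :=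
  if c.IsTurned j then halfTurn else IsometryEquiv.refl Plane

open Classical in
def side (c : RowPattern) (j : ℤ) : ℝ → ℝ :=
  if c.IsTurned j then fun y => -(c.kind j).side (64 - y) else (c.kind j).side

/-- The curve below the `j`-th row. -/
def curve : RowPattern → ℤ → ℝ → ℝ
  | .allPurple, _ => upProfile
  | .allRed, _ => selfProfile
  | .greenOverRed, j => if 0 < j then upProfile else selfProfile
  | .redBetweenGreen n, j =>
      if 0 < j then upProfile
      else if -(n : ℤ) ≤ j then selfProfile
      else fun x => -upProfile (64 - x)

open Classical in
theorem row_eq (c : RowPattern) (j : ℤ) :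
    c.row j = if c.IsTurned j then turned (c.kind j).tile else (c.kind j).tile := by
  rcases c with _ | _ | _ | n
  · simp [IsTurned, row, kind]
    rfl
  · simp [IsTurned, row, kind]
    rfl
  · rw [if_neg (show ¬ IsTurned .greenOverRed j from id)]
    simp only [row, kind]
    split_ifs <;> rfl
  · simp only [IsTurned, row, kind]
    split_ifs <;> first | rfl | omega

theorem row_eq_image (c : RowPattern) (j : ℤ) : c.row j = c.flip j '' (c.kind j).tile := by
  rw [row_eq, flip]
  split_ifs
  · exact turned_eq_image _
  · exact (Set.image_id _).symm

/-- Adjacent rows share one curve. Below a turned green row's upper neighbour this works because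
`selfProfile` is unchanged by the half-turn, whether that neighbour is red or, for `n = 0`, green.
-/
theorem row_eq_block (c : RowPattern) (j : ℤ) :
    c.row j = block (c.side j) (c.curve j) (c.curve (j + 1)) := by
  have hself : (fun x => -selfProfile (64 - x)) = selfProfile := by
    ext x
    rw [selfProfile_turn, neg_neg]
  have htile : (c.kind j).tile = block (c.kind j).side (c.kind j).low (c.kind j).up := rfl
  rw [row_eq, side, htile, turned_block]
  rcases c with _ | _ | _ | n
  · simp [IsTurned, kind, curve, Kind.low, Kind.up]
  · simp [IsTurned, kind, curve, Kind.low, Kind.up]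
  · have ht : ¬ IsTurned .greenOverRed j := id
    rw [if_neg ht, if_neg ht]
    rcases lt_trichotomy 0 j with hj | rfl | hj
    · have h1 : kind .greenOverRed j = .purple := if_pos hj
      have h2 : curve .greenOverRed j = upProfile := if_pos hj
      have h3 : curve .greenOverRed (j + 1) = upProfile := if_pos (by omega)
      rw [h1, h2, h3]
      rfl
    · rfl
    · have h1 : kind .greenOverRed j = .red := by
        simp only [kind]
        split_ifs <;> first | rfl | omega
      have h2 : curve .greenOverRed j = selfProfile := if_neg (by omega)
      have h3 : curve .greenOverRed (j + 1) = selfProfile := if_neg (by omega)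
      rw [h1, h2, h3]
      rfl
  · have up (j : ℤ) (hj : 0 < j) : curve (.redBetweenGreen n) j = upProfile := if_pos hj
    have self (j : ℤ) (hj : j ≤ 0) (hj' : -(n : ℤ) ≤ j) :
        curve (.redBetweenGreen n) j = selfProfile := by
      simp only [curve]
      rw [if_neg (by omega), if_pos hj']
    have down (j : ℤ) (hj : j < -(n : ℤ)) :
        curve (.redBetweenGreen n) j = fun x => -upProfile (64 - x) := by
      simp only [curve]
      rw [if_neg (by omega), if_neg (by omega)]
    rcases lt_or_ge j (-(n : ℤ)) with hj | hj
    · have ht : IsTurned (.redBetweenGreen n) j := hj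
      rw [if_pos ht, if_pos ht, down j hj]
      rcases eq_or_ne j (-(n : ℤ) - 1) with hj' | hj'
      · have h1 : kind (.redBetweenGreen n) j = .green := by
          simp only [kind]
          split_ifs <;> first | rfl | omega
        rw [h1, self (j + 1) (by omega) (by omega), ← hself]
        rfl
      · have h1 : kind (.redBetweenGreen n) j = .purple := by
          simp only [kind]
          split_ifs <;> first | rfl | omega
        rw [h1, down (j + 1) (by omega)]
        rfl
    · have ht : ¬ IsTurned (.redBetweenGreen n) j := not_lt.2 hj
      rw [if_neg ht, if_neg ht]
      rcases lt_trichotomy 0 j with hj' | rfl | hj'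
      · have h1 : kind (.redBetweenGreen n) j = .purple := if_pos hj'
        rw [h1, up j hj', up (j + 1) (by omega)]
        rfl
      · rw [self 0 le_rfl hj, up (0 + 1) (by omega)]
        rfl
      · have h1 : kind (.redBetweenGreen n) j = .red := by
          simp only [kind]
          split_ifs <;> first | rfl | omega
        rw [h1, self j (by omega) hj, self (j + 1) (by omega) (by omega)]
        rfl

theorem rowCurves (c : RowPattern) : RowCurves c.side c.curve := by
  have hside : ∀ j, (∀ y, c.side j y = (c.kind j).side y) ∨
      ∀ y, c.side j y = -(c.kind j).side (64 - y) := by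
    intro j
    unfold side
    split_ifs
    · exact Or.inr fun y => rfl
    · exact Or.inl fun y => rfl
  have hcurve : ∀ j, ∃ (k : Kind), (∀ x, c.curve j x = k.up x) ∨
      ∀ x, c.curve j x = -k.up (64 - x) := by
    intro j
    rcases c with _ | _ | _ | n
    · exact ⟨.purple, Or.inl fun _ => rfl⟩
    · exact ⟨.red, Or.inl fun _ => rfl⟩
    · simp only [curve]
      split_ifs
      exacts [⟨.purple, Or.inl fun _ => rfl⟩, ⟨.red, Or.inl fun _ => rfl⟩]
    · simp only [curve]
      split_ifs
      exacts [⟨.purple, Or.inl fun _ => rfl⟩, ⟨.red, Or.inl fun _ => rfl⟩,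
        ⟨.purple, Or.inr fun _ => rfl⟩]
  constructor
  · intro j y
    rcases hside j with h | h <;> rw [h]
    · exact (c.kind j).side_profile.le_eight y
    · linarith [(c.kind j).side_profile.neg_eight_le (64 - y)]
  · intro j y
    rcases hside j with h | h <;> rw [h]
    · exact (c.kind j).side_profile.neg_eight_le y
    · linarith [(c.kind j).side_profile.le_eight (64 - y)]
  · intro j y hy
    rcases hside j with h | h <;> rw [h]
    · exact (c.kind j).side_profile.eq_zero_left y (by linarith)
    · rw [(c.kind j).side_eq_zero (by linarith), neg_zero]
  · intro j y hy
    rcases hside j with h | h <;> rw [h]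
    · exact (c.kind j).side_eq_zero hy
    · rw [(c.kind j).side_profile.eq_zero_left _ (by linarith), neg_zero]
  · intro j x
    obtain ⟨k, h | h⟩ := hcurve j <;> rw [h]
    · exact k.up_profile.le_eight x
    · linarith [k.up_profile.neg_eight_le (64 - x)]
  · intro j x
    obtain ⟨k, h | h⟩ := hcurve j <;> rw [h]
    · exact k.up_profile.neg_eight_le x
    · linarith [k.up_profile.le_eight (64 - x)]
  · intro j
    obtain ⟨k, h | h⟩ := hcurve j <;> rw [h]
    · exact k.up_profile.eq_zero_left _ (by norm_num)
    · rw [k.up_profile.eq_zero_right _ (by norm_num), neg_zero]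
  · intro j
    obtain ⟨k, h | h⟩ := hcurve j <;> rw [h]
    · exact k.up_profile.eq_zero_right _ (by norm_num)
    · rw [k.up_profile.eq_zero_left _ (by norm_num), neg_zero]

theorem shifted_row_eq (c : RowPattern) (i j : ℤ) :
    shifted (c.row j) i j = ((c.flip j).trans (move i j)) '' (c.kind j).tile := by
  rw [shifted_eq_image, row_eq_image, image_trans]

theorem isTilingBy (c : RowPattern) : IsTilingBy rowProtoset c.tiling := by
  have heq : c.tiling = rowTiling (fun j => block (c.side j) (c.curve j) (c.curve (j + 1))) := by
    rw [tiling]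
    congr 1
    ext1 j
    exact c.row_eq_block j
  refine ⟨⟨rowTiling_countable _, ?_, ?_, ?_⟩, ?_⟩
  · rintro _ ⟨i, j, rfl⟩
    rw [shifted_row_eq]
    exact (c.kind j).isClosedDisc.image ((c.flip j).trans (move i j)).toHomeomorph
  · rw [heq]
    exact c.rowCurves.covers
  · rw [heq]
    exact c.rowCurves.interiors
  · rintro _ ⟨i, j, rfl⟩
    refine ⟨(c.kind j).tile, ?_, _, (c.shifted_row_eq i j).symm⟩
    rw [rowProtoset_eq_range]
    exact ⟨_, rfl⟩

end RowPattern

end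

/-! ### Every tiling is a row pattern -/

noncomputable section

/-- Isometric images of different prototiles are different. -/
theorem Kind.eq_of_image_eq {k k' : Kind} {φ ψ : Plane ≃ᵢ Plane}
    (h : φ '' k.tile = ψ '' k'.tile) : k = k' := by
  have h' : (φ.trans ψ.symm) '' k.tile = k'.tile := by
    rw [image_trans, h]
    exact ψ.toEquiv.symm_image_image _
  -- The right bumps have types 3, 5 and 7, each of which occurs on a single kind.
  obtain ⟨e, he, -⟩ := k.exists_bump_of_congruent k' _ h' .right
  cases k <;> cases k' <;> first | rfl |
    cases e <;>
    norm_num [bumpType, sideType₁, sideType₂, lowType₂, upType₁] at he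

/-- The green tile has no symmetry. -/
theorem eq_of_image_green_eq {φ ψ : Plane ≃ᵢ Plane}
    (h : φ '' Kind.green.tile = ψ '' Kind.green.tile) : φ = ψ := by
  have h' : (φ.trans ψ.symm) '' Kind.green.tile = Kind.green.tile := by
    rw [image_trans, h]
    exact ψ.toEquiv.symm_image_image _
  -- The four bumps of the green tile have the distinct types 6, 5, 8, 9. So the right bump is
  -- carried to itself, which determines the isometry.
  obtain ⟨e, he, hφ⟩ := Kind.green.exists_bump_of_congruent .green _ h' .right
  cases e <;>
    norm_num [Kind.bumpType, Kind.sideType₁, Kind.sideType₂, Kind.lowType₂, Kind.upType₁] at he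
  ext1 p
  have := congrArg (fun χ : Plane ≃ᵢ Plane => ψ (χ ((Kind.green.bumpIso .right).symm p))) hφ
  simpa using this

/-- A further tile of `𝒯` would have interior points, and these are already covered by tiles of `ℛ`.
-/
theorem IsTilingBy.eq_of_subset {𝒯 ℛ : Set (Set Plane)} (h𝒯 : IsTilingBy rowProtoset 𝒯)
    (hℛ : IsTilingBy rowProtoset ℛ) (hsub : ℛ ⊆ 𝒯) : ℛ = 𝒯 := by
  refine hsub.antisymm fun T hT => ?_
  obtain ⟨k, φ, hk⟩ := h𝒯.exists_kind hT
  obtain ⟨p, hp⟩ := k.interior_nonempty φ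
  rw [hk] at hp
  obtain ⟨S, hS, hpS⟩ := Set.mem_sUnion.1 (hℛ.isTiling.covers ▸ Set.mem_univ p)
  by_contra hT'
  refine Set.disjoint_left.1 (h𝒯.disjoint_interior hT (hsub hS) ?_) hp hpS
  rintro rfl
  exact hT' hS

namespace RowPattern

theorem flip_trans_move (c : RowPattern) (i j : ℤ) : ∃ i',
    (c.flip j).trans (move i j) = (move i' 0).trans ((c.flip j).trans (move 0 j)) := by
  unfold flip
  split_ifs
  · refine ⟨-i, ?_⟩
    rw [← isometryEquiv_trans_assoc, move_trans_halfTurn, isometryEquiv_trans_assoc,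
      move_trans_move]
    simp
  · refine ⟨i, ?_⟩
    change move i j = (move i 0).trans (move 0 j)
    rw [move_trans_move]
    simp

/-- A tiling that contains one tile of each row of a pattern is congruent to that pattern. -/
theorem congruent_of_rows (c : RowPattern) {𝒯 : Set (Set Plane)}
    (h : IsTilingBy rowProtoset 𝒯) (φ : Plane ≃ᵢ Plane)
    (hrow : ∀ j, (((c.flip j).trans (move 0 j)).trans φ) '' (c.kind j).tile ∈ 𝒯) :
    CongruentTilings c.tiling 𝒯 := by
  refine ⟨φ, h.eq_of_subset (c.isTilingBy.image φ) ?_⟩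
  rintro _ ⟨_, ⟨i, j, rfl⟩, rfl⟩
  obtain ⟨i', hi'⟩ := c.flip_trans_move i j
  simp only
  rw [shifted_row_eq, ← image_trans, hi', isometryEquiv_trans_assoc]
  exact h.row_mem _ _ (hrow j) i'

/-- The tiling is read off from the column through one green tile. Its purple part above is forced;
below, the only choice is the depth at which a turned green tile first appears, if any. -/
theorem exists_congruent_of_green {𝒯 : Set (Set Plane)} (h : IsTilingBy rowProtoset 𝒯)
    (φ : Plane ≃ᵢ Plane) (hφ : φ '' Kind.green.tile ∈ 𝒯) :
    ∃ c : RowPattern, CongruentTilings c.tiling 𝒯 := by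
  have hup : ∀ j : ℤ, 0 < j → ((move 0 j).trans φ) '' Kind.purple.tile ∈ 𝒯 := by
    intro j hj
    obtain ⟨n, rfl⟩ : ∃ n : ℕ, j = n + 1 := ⟨(j - 1).toNat, by omega⟩
    exact h.purple_above φ (by simp) hφ n
  have hstep : ∀ (χ : Plane ≃ᵢ Plane) (j : ℤ),
      (halfTurn.trans (move 0 (-1))).trans ((move 0 j).trans χ) =
        (halfTurn.trans (move 0 (j - 1))).trans χ := by
    intro χ j
    rw [← isometryEquiv_trans_assoc, isometryEquiv_trans_assoc halfTurn, move_trans_move,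
      zero_add, neg_add_eq_sub]
  have hstep' : ∀ (χ : Plane ≃ᵢ Plane) (j : ℤ),
      (move 0 (-1)).trans ((move 0 j).trans χ) = (move 0 (j - 1)).trans χ := by
    intro χ j
    rw [← isometryEquiv_trans_assoc, move_trans_move, zero_add, neg_add_eq_sub]
  have hzero : ((move 0 0).trans φ) '' Kind.green.tile ∈ 𝒯 := by rwa [move_zero]
  have hdown : ∀ m : ℕ,
      (∀ l < m, ((halfTurn.trans (move 0 (-l - 1))).trans φ) '' Kind.green.tile ∉ 𝒯) →
      ∀ l < m, ((move 0 (-l - 1)).trans φ) '' Kind.red.tile ∈ 𝒯 := by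
    intro m hm l
    induction l with
    | zero =>
      intro hl
      have h1 := h.below_of_ne_purple _ (by simp) hzero
      rw [hstep, hstep'] at h1
      have h2 := hm 0 hl
      rw [Nat.cast_zero, neg_zero] at h2 ⊢
      exact h1.resolve_right h2
    | succ l ih =>
      intro hl
      have h1 := h.below_of_ne_purple _ (by simp) (ih (by omega))
      rw [hstep, hstep', show -(l : ℤ) - 1 - 1 = -((l + 1 : ℕ) : ℤ) - 1 by push_cast; ring] at h1
      exact h1.resolve_right (hm (l + 1) hl)
  by_cases hex : ∃ n : ℕ, ((halfTurn.trans (move 0 (-n - 1))).trans φ) '' Kind.green.tile ∈ 𝒯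
  · classical
    -- Minimality of the depth makes the `n` tiles in between red.
    set n := Nat.find hex with hn
    have hgreen := Nat.find_spec hex
    rw [← hn] at hgreen
    have hred := hdown n fun l hl => Nat.find_min hex hl
    refine ⟨.redBetweenGreen n, congruent_of_rows _ h φ fun j => ?_⟩
    rcases lt_or_ge j (-(n : ℤ)) with hj | hj
    · have hf : flip (.redBetweenGreen n) j = halfTurn := if_pos hj
      rw [hf]
      rcases eq_or_ne j (-(n : ℤ) - 1) with rfl | hj'
      · have hk : kind (.redBetweenGreen n) (-(n : ℤ) - 1) = .green := by
          simp only [kind]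
          split_ifs <;> first | rfl | omega
        rwa [hk]
      · have hk : kind (.redBetweenGreen n) j = .purple := by
          simp only [kind]
          split_ifs <;> first | rfl | omega
        obtain ⟨m, hm⟩ : ∃ m : ℕ, j = -n - 1 - (m + 1) := ⟨(-n - 1 - j - 1).toNat, by omega⟩
        -- In the orientation of the turned green tile, going up means going down in the plane.
        have h1 := h.purple_above _ (by simp) hgreen m
        rw [← isometryEquiv_trans_assoc, ← isometryEquiv_trans_assoc, move_trans_halfTurn,
          isometryEquiv_trans_assoc halfTurn, move_trans_move,
          show -0 + 0 = (0 : ℤ) by norm_num,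
          show -((m : ℤ) + 1) + (-n - 1) = j by omega] at h1
        rwa [hk]
    · have hf : flip (.redBetweenGreen n) j = IsometryEquiv.refl Plane := if_neg (not_lt.2 hj)
      rw [hf]
      change ((move 0 j).trans φ) '' _ ∈ 𝒯
      rcases lt_trichotomy 0 j with hj' | rfl | hj'
      · have hk : kind (.redBetweenGreen n) j = .purple := if_pos hj'
        rw [hk]
        exact hup j hj'
      · exact hzero
      · have hk : kind (.redBetweenGreen n) j = .red := by
          simp only [kind]
          split_ifs <;> first | rfl | omega
        obtain ⟨l, rfl⟩ : ∃ l : ℕ, j = -l - 1 := ⟨(-j - 1).toNat, by omega⟩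
        rw [hk]
        exact hred l (by omega)
  · push Not at hex
    refine ⟨.greenOverRed, congruent_of_rows _ h φ fun j => ?_⟩
    have hf : flip .greenOverRed j = IsometryEquiv.refl Plane := if_neg id
    rw [hf]
    change ((move 0 j).trans φ) '' _ ∈ 𝒯
    rcases lt_trichotomy 0 j with hj' | rfl | hj'
    · have hk : kind .greenOverRed j = .purple := if_pos hj'
      rw [hk]
      exact hup j hj'
    · exact hzero
    · have hk : kind .greenOverRed j = .red := by
        simp only [kind]
        split_ifs <;> first | rfl | omega
      obtain ⟨l, rfl⟩ : ∃ l : ℕ, j = -l - 1 := ⟨(-j - 1).toNat, by omega⟩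
      rw [hk]
      exact hdown (l + 1) (fun l _ => hex l) l (by omega)

/-- Going up and down from one tile of a kind that is preserved. -/
theorem forall_rows_mem {𝒯 : Set (Set Plane)} {k : Kind}
    (hup : ∀ φ : Plane ≃ᵢ Plane, φ '' k.tile ∈ 𝒯 → ((move 0 1).trans φ) '' k.tile ∈ 𝒯)
    (hdown : ∀ φ : Plane ≃ᵢ Plane, φ '' k.tile ∈ 𝒯 → ((move 0 (-1)).trans φ) '' k.tile ∈ 𝒯)
    (φ : Plane ≃ᵢ Plane) (hφ : φ '' k.tile ∈ 𝒯) (j : ℤ) :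
    ((move 0 j).trans φ) '' k.tile ∈ 𝒯 := by
  induction j using Int.induction_on with
  | zero => rwa [move_zero]
  | succ j ih =>
    have := hup _ ih
    rwa [← isometryEquiv_trans_assoc, move_trans_move, add_comm 1, zero_add] at this
  | pred j ih =>
    have := hdown _ ih
    rwa [← isometryEquiv_trans_assoc, move_trans_move, zero_add, neg_add_eq_sub] at this

/-- Without green tiles each alternative in the matching rules disappears, so one purple tile forces
purple everywhere, and otherwise all tiles are red. -/
theorem exists_congruent {𝒯 : Set (Set Plane)} (h : IsTilingBy rowProtoset 𝒯) :
    ∃ c : RowPattern, CongruentTilings c.tiling 𝒯 := by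
  by_cases hgreen : ∃ φ : Plane ≃ᵢ Plane, φ '' Kind.green.tile ∈ 𝒯
  · obtain ⟨φ, hφ⟩ := hgreen
    exact exists_congruent_of_green h φ hφ
  push Not at hgreen
  by_cases hpurple : ∃ φ : Plane ≃ᵢ Plane, φ '' Kind.purple.tile ∈ 𝒯
  · obtain ⟨φ, hφ⟩ := hpurple
    refine ⟨.allPurple, congruent_of_rows _ h φ fun j => ?_⟩
    have hf : flip .allPurple j = IsometryEquiv.refl Plane := if_neg id
    rw [hf]
    exact forall_rows_mem (fun ψ hψ => h.above_of_ne_red ψ (by simp) hψ)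
      (fun ψ hψ => (h.below_purple ψ hψ).resolve_right (hgreen _)) φ hφ j
  push Not at hpurple
  obtain ⟨T, hT, -⟩ := Set.mem_sUnion.1 (h.isTiling.covers ▸ Set.mem_univ (0 : Plane))
  obtain ⟨k, φ, rfl⟩ := h.exists_kind hT
  have hk : k = .red := by
    cases k
    exacts [absurd hT (hpurple φ), absurd hT (hgreen φ), rfl]
  subst hk
  refine ⟨.allRed, congruent_of_rows _ h φ fun j => ?_⟩
  have hf : flip .allRed j = IsometryEquiv.refl Plane := if_neg id
  rw [hf]
  exact forall_rows_mem (fun ψ hψ => (h.above_red ψ hψ).resolve_right (hgreen _))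
    (fun ψ hψ => (h.below_of_ne_purple ψ (by simp) hψ).resolve_right (hgreen _)) φ hT j

theorem kind_redBetweenGreen_eq_green_iff (n : ℕ) (j : ℤ) :
    kind (.redBetweenGreen n) j = .green ↔ j = 0 ∨ j = -(n : ℤ) - 1 := by
  simp only [kind]
  split_ifs <;> simp <;> omega

theorem kind_greenOverRed_eq_green_iff (j : ℤ) : kind .greenOverRed j = .green ↔ j = 0 := by
  simp only [kind]
  split_ifs <;> simp <;> omega

theorem kind_injective {c c' : RowPattern} (h : ∀ j, c.kind j = c'.kind j) : c = c' := by
  have hg : ∀ j, c.kind j = .green ↔ c'.kind j = .green := fun j => by rw [h j]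
  have h0 := h 0
  rcases c with _ | _ | _ | n <;> rcases c' with _ | _ | _ | n' <;>
    first
    | rfl
    | simp [kind] at h0
      done
    | skip
  · have := (hg (-(n' : ℤ) - 1)).2 ((kind_redBetweenGreen_eq_green_iff _ _).2 (Or.inr rfl))
    rw [kind_greenOverRed_eq_green_iff] at this
    omega
  · have := (hg (-(n : ℤ) - 1)).1 ((kind_redBetweenGreen_eq_green_iff _ _).2 (Or.inr rfl))
    rw [kind_greenOverRed_eq_green_iff] at this
    omega
  · have := (hg (-(n : ℤ) - 1)).1 ((kind_redBetweenGreen_eq_green_iff _ _).2 (Or.inr rfl))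
    rw [kind_redBetweenGreen_eq_green_iff] at this
    have : n = n' := by omega
    rw [this]

/-- This is the half-turn symmetry of the pattern, which exchanges its two green rows. -/
theorem kind_redBetweenGreen_reflect (n : ℕ) (j : ℤ) :
    kind (.redBetweenGreen n) (-(n : ℤ) - 1 - j) = kind (.redBetweenGreen n) j := by
  simp only [kind]
  split_ifs <;> first | rfl | omega

end RowPattern

end

/-! ### Different patterns are not congruent -/

noncomputable section

theorem Kind.centre_mem_interior (k : Kind) (φ : Plane ≃ᵢ Plane) :
    φ Kind.centre ∈ interior (φ '' k.tile) := by
  have h : φ.toHomeomorph '' interior k.tile = interior (φ.toHomeomorph '' k.tile) :=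
    φ.toHomeomorph.image_interior k.tile
  have h' : Kind.centre ∈ interior k.tile :=
    interior_maximal k.ball_subset_tile Metric.isOpen_ball (Metric.mem_ball_self (by norm_num))
  exact h ▸ Set.mem_image_of_mem φ h'

namespace RowPattern

/-- Centres are fixed by the half-turn about them, so they locate a tile regardless of its
orientation. -/
theorem flip_trans_move_centre (c : RowPattern) (i j : ℤ) :
    ((c.flip j).trans (move i j)) Kind.centre = move i j Kind.centre := by
  unfold flip
  split_ifs
  · refine plane_ext ?_ ?_ <;> simp [halfTurn, move] <;> norm_num
  · rfl

/-- A tile of a row tiling whose interior contains the centre of a square is of the kind of the row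
of that square. -/
theorem kind_eq_of_centre_mem (c : RowPattern) {k : Kind} {ψ : Plane ≃ᵢ Plane}
    (hmem : ψ '' k.tile ∈ c.tiling) {i j : ℤ}
    (hψ : ψ Kind.centre = move i j Kind.centre) : k = c.kind j := by
  have hS : shifted (c.row j) i j ∈ c.tiling := ⟨i, j, rfl⟩
  have h1 := k.centre_mem_interior ψ
  have h2 := (c.kind j).centre_mem_interior ((c.flip j).trans (move i j))
  rw [← shifted_row_eq, flip_trans_move_centre, ← hψ] at h2
  have heq : ψ '' k.tile = shifted (c.row j) i j := by
    by_contra hne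
    exact Set.disjoint_left.1 (c.isTilingBy.disjoint_interior hmem hS hne) h1 (interior_subset h2)
  rw [shifted_row_eq] at heq
  exact Kind.eq_of_image_eq heq

/-- Every kind of tile that occurs in a tiling occurs in each tiling congruent to it. -/
theorem exists_kind_eq {c c' : RowPattern} (h : CongruentTilings c.tiling c'.tiling) (j : ℤ) :
    ∃ j', c.kind j = c'.kind j' := by
  obtain ⟨φ, hφ⟩ := h
  have hmem : φ '' shifted (c.row j) 0 j ∈ c'.tiling := by
    rw [← hφ]
    exact ⟨_, ⟨0, j, rfl⟩, rfl⟩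
  obtain ⟨i', j', h'⟩ := hmem
  rw [shifted_row_eq, shifted_row_eq, ← image_trans] at h'
  exact ⟨j', Kind.eq_of_image_eq h'⟩

/-- Such a pattern has a single kind of tile, and the kind of row 0 of `c'` must be that one. -/
theorem eq_of_kind_zero_ne_green {c c' : RowPattern} (h : CongruentTilings c.tiling c'.tiling)
    (h0 : c.kind 0 ≠ .green) : c = c' := by
  obtain ⟨j, hj⟩ := exists_kind_eq h.symm 0
  rcases c with _ | _ | _ | n
  · rcases c' with _ | _ | _ | n' <;> first | rfl | simp [kind] at hj
  · rcases c' with _ | _ | _ | n' <;> first | rfl | simp [kind] at hj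
  · exact absurd rfl h0
  · exact absurd rfl h0

/-- The green tile in row 0 of `c` goes to a green tile of `c'`. As green has no symmetry, this
determines `φ`, and following the centres of the rows shows that the sequences of kinds agree. -/
theorem eq_of_congruent {c c' : RowPattern} (h : CongruentTilings c.tiling c'.tiling) :
    c = c' := by
  by_cases h0 : c.kind 0 = .green
  swap
  · exact eq_of_kind_zero_ne_green h h0
  by_cases h0' : c'.kind 0 = .green
  swap
  · exact (eq_of_kind_zero_ne_green h.symm h0').symm
  obtain ⟨φ, hφ⟩ := h
  have hmem : ∀ j, (((c.flip j).trans (move 0 j)).trans φ) '' (c.kind j).tile ∈ c'.tiling := by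
    intro j
    rw [image_trans, ← shifted_row_eq, ← hφ]
    exact ⟨_, ⟨0, j, rfl⟩, rfl⟩
  have hflip : c.flip 0 = IsometryEquiv.refl Plane := by
    refine if_neg ?_
    rcases c with _ | _ | _ | n <;> simp [IsTurned]
  have hgreen := hmem 0
  rw [h0, hflip, move_zero] at hgreen
  obtain ⟨i, J, hJ⟩ := hgreen
  rw [shifted_row_eq] at hJ
  have hkJ := Kind.eq_of_image_eq hJ
  rw [← hkJ] at hJ
  have hφ' : φ = (c'.flip J).trans (move i J) := eq_of_image_green_eq hJ
  have hcentre : ∀ j, (((c.flip j).trans (move 0 j)).trans φ) Kind.centre =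
      φ (move 0 j Kind.centre) := by
    intro j
    rw [IsometryEquiv.trans_apply, flip_trans_move_centre]
  refine kind_injective fun j => ?_
  rcases c' with _ | _ | _ | n
  · simp [kind] at h0'
  · simp [kind] at h0'
  · obtain rfl := (kind_greenOverRed_eq_green_iff J).1 hkJ.symm
    refine kind_eq_of_centre_mem _ (hmem j) (i := i) (j := j) ?_
    rw [hcentre, hφ', show flip .greenOverRed 0 = IsometryEquiv.refl Plane from if_neg id]
    change move i 0 (move 0 j Kind.centre) = move i j Kind.centre
    refine plane_ext ?_ ?_ <;> simp [move]
  · rcases (kind_redBetweenGreen_eq_green_iff n J).1 hkJ.symm with rfl | rfl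
    · refine kind_eq_of_centre_mem _ (hmem j) (i := i) (j := j) ?_
      rw [hcentre, hφ',
        show flip (.redBetweenGreen n) 0 = IsometryEquiv.refl Plane from if_neg (by simp [IsTurned])]
      change move i 0 (move 0 j Kind.centre) = move i j Kind.centre
      refine plane_ext ?_ ?_ <;> simp [move]
    -- Here the image is the turned green row, so `φ` is a half-turn that takes row `j` to row `-n -
    -- 1 - j`; the symmetry of the pattern compensates for this.
    · rw [← kind_redBetweenGreen_reflect]
      refine kind_eq_of_centre_mem _ (hmem j) (i := i) ?_
      rw [hcentre, hφ',
        show flip (.redBetweenGreen n) (-n - 1) = halfTurn from if_pos (by simp [IsTurned])]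
      refine plane_ext ?_ ?_
      · simp [move, halfTurn]
        norm_num
      · simp [move, halfTurn]
        ring

instance : Infinite RowPattern :=
  Infinite.of_injective RowPattern.redBetweenGreen fun _ _ h => RowPattern.redBetweenGreen.inj h

instance : Countable RowPattern := by
  refine Function.Injective.countable (f := fun c : RowPattern => match c with
    | .allPurple => (0 : ℕ)
    | .allRed => 1
    | .greenOverRed => 2
    | .redBetweenGreen n => n + 3) ?_
  rintro (_ | _ | _ | n) (_ | _ | _ | n') h <;> simp at h ⊢
  exact h

end RowPattern

theorem isSigmaMorphic_rowProtoset : IsSigmaMorphic rowProtoset := by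
  have hbij : Function.Bijective fun c : RowPattern =>
      (Quotient.mk (tilingSetoid rowProtoset) ⟨c.tiling, c.isTilingBy⟩) := by
    constructor
    · intro c c' h
      exact RowPattern.eq_of_congruent (Quotient.exact h)
    · intro q
      obtain ⟨⟨𝒯, h⟩, rfl⟩ := Quotient.exists_rep q
      obtain ⟨c, hc⟩ := RowPattern.exists_congruent h
      exact ⟨c, Quotient.sound hc⟩
  rw [IsSigmaMorphic, ← Cardinal.mk_congr (Equiv.ofBijective _ hbij), Cardinal.mk_eq_aleph0]

end

theorem theorem1 :
    (∀ P ∈ rowProtoset, IsClosedDisc P) ∧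
    (¬ CongruentFigures purpleTile greenTile ∧ ¬ CongruentFigures purpleTile redTile ∧
      ¬ CongruentFigures greenTile redTile) ∧
    IsSigmaMorphic rowProtoset ∧
    (∀ c : RowPattern, IsTilingBy rowProtoset c.tiling) ∧
    (∀ 𝒯 : Set (Set Plane), IsTilingBy rowProtoset 𝒯 →
      ∃! c : RowPattern, CongruentTilings c.tiling 𝒯) := by
  have hne : ∀ k k' : Kind, CongruentFigures k.tile k'.tile → k = k' := by
    rintro k k' ⟨φ, hφ⟩
    refine Kind.eq_of_image_eq (φ := φ) (ψ := IsometryEquiv.refl Plane) (hφ.trans ?_)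
    exact (Set.image_id _).symm
  refine ⟨?_, ⟨?_, ?_, ?_⟩, isSigmaMorphic_rowProtoset, RowPattern.isTilingBy, ?_⟩
  · rw [rowProtoset_eq_range]
    rintro _ ⟨k, rfl⟩
    exact k.isClosedDisc
  · intro h
    exact Kind.noConfusion (hne .purple .green h)
  · intro h
    exact Kind.noConfusion (hne .purple .red h)
  · intro h
    exact Kind.noConfusion (hne .green .red h)
  · intro 𝒯 h
    obtain ⟨c, hc⟩ := RowPattern.exists_congruent h
    exact ⟨c, hc, fun c' hc' => RowPattern.eq_of_congruent (hc'.trans hc.symm)⟩
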